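/- Let $d \ge 2$ and $n \ge d+2$. A configuration is a sequence of $n$ points in $\mathbb{R}^d$; it is generic if its $dn$ coordinates satisfy no non-trivial polynomial equation with rational coefficients. An edge measurement ensemble is a finite sequence of edges $\{i,j\}$, $i \ne j$, of the complete graph on the vertices $\{1,\dots,n\}$ (repetitions allowed). For such an ensemble $G=(G_1,\dots,G_k)$ and a configuration $\mathbf p$, let $\langle G,\mathbf p\rangle^2$ denote the sequence of the squared Euclidean lengths of $G_1,\dots,G_k$ in $\mathbf p$, where the length of $\{i,j\}$ is $|\mathbf p_i-\mathbf p_j|$. The ensemble $G$ allows for trilateration if, after some reordering of the vertices, it includes all edges of the complete graph on $\{1,\dots,d+2\}$ and, for every $j$ with $d+2<j\le n$, it includes edges $\{i_1,j\},\dots,\{i_{d+1},j\}$ for some distinct $i_1,\dots,i_{d+1}<j$. Theorem 5.12. Let $\mathbf p$ be a generic configuration of $n$ points in $\mathbb{R}^d$, and let $\mathbf v=\langle G,\mathbf p\rangle^2$, where $G$ is an edge measurement ensemble that allows for trilateration. Suppose that there are a configuration $\mathbf q$, also of $n$ points in $\mathbb{R}^d$, and an edge measurement ensemble $H$ such that $\mathbf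 v=\langle H,\mathbf q\rangle^2$. Then there is a relabeling of the vertices, i.e. a permutation $\sigma$ of $\{1,\dots,n\}$, such that the configuration $(\mathbf q_{\sigma^{-1}(1)},\dots,\mathbf q_{\sigma^{-1}(n)})$ is congruent to $\mathbf p$ (some isometry of $\mathbb{R}^d$ maps the one to the other, in order), and, under the same relabeling, $H=G$: replacing each edge $\{i,j\}$ of $H$ by $\{\sigma(i),\sigma(j)\}$ gives exactly the sequence $G$. -/

import Mathlib

namespace UnlabeledTrilateration

/-- A configuration: a sequence of `n` points of Euclidean space `ℝ^d`. -/
abbrev Configuration (d n : ℕ) := Fin n → EuclideanSpace ℝ (Fin d)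

/-- An edge of `K_n`: an unordered pair of distinct vertices. -/
abbrev Edge (n : ℕ) := {e : Sym2 (Fin n) // ¬ e.IsDiag}

/-- An edge measurement ensemble: a finite sequence of edges of `K_n`. Repetitions are allowed;
the sequences of distinct edges (ordered graphs) are a special case. -/
abbrev EdgeEnsemble (n : ℕ) := List (Edge n)

/-- A configuration is generic if its `d * n` coordinates satisfy no nonzero polynomial equation
with rational coefficients. -/
def IsGeneric {d n : ℕ} (p : Configuration d n) : Prop :=
  AlgebraicIndependent ℚ (fun ij : Fin n × Fin d => p ij.1 ij.2)

/-- The length of the edge `{i, j}` in `p`: the Euclidean distance from `p i` to `p j`. -/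
noncomputable def edgeLength {d n : ℕ} (p : Configuration d n) (e : Edge n) : ℝ :=
  Sym2.lift ⟨fun i j => dist (p i) (p j), fun i j => dist_comm (p i) (p j)⟩ e.1

/-- The data set `⟨G, p⟩²`: the sequence of squared lengths in `p` of the edges of `G`. -/
noncomputable def squaredData {d n : ℕ} (G : EdgeEnsemble n) (p : Configuration d n) : List ℝ :=
  G.map fun e => edgeLength p e ^ 2

/-- The edge `{i, j}` occurs in the ensemble `G`. -/
def Includes {n : ℕ} (G : EdgeEnsemble n) (i j : Fin n) : Prop :=
  ∃ e ∈ G, e.1 = s(i, j)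

/-- `G` allows for trilateration in dimension `d`: after some reordering `π` of the vertices,
`G` includes all edges of the complete graph on the first `d + 2` vertices, and each later vertex
is joined by edges of `G` to (at least) `d + 1` distinct earlier vertices.
Vertices are numbered from `0`. -/
def AllowsTrilateration (d : ℕ) {n : ℕ} (G : EdgeEnsemble n) : Prop :=
  d + 2 ≤ n ∧ ∃ π : Equiv.Perm (Fin n),
    (∀ i j : Fin n, (i : ℕ) < d + 2 → (j : ℕ) < d + 2 → i ≠ j → Includes G (π i) (π j)) ∧
    ∀ j : Fin n, d + 2 ≤ (j : ℕ) →
      ∃ r : Fin (d + 1) ↪ Fin n, ∀ k, r k < j ∧ Includes G (π (r k)) (π j)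

/-- The edge `{σ i, σ j}` obtained from `{i, j}` when each vertex `i` is renamed `σ i`. -/
def relabelEdge {n : ℕ} (σ : Equiv.Perm (Fin n)) (e : Edge n) : Edge n :=
  ⟨e.1.map σ, fun h => e.2 ((Sym2.isDiag_map σ.injective).1 h)⟩

/-- The ensemble obtained from `G` when each vertex `i` is renamed `σ i`. -/
def relabelEnsemble {n : ℕ} (σ : Equiv.Perm (Fin n)) (G : EdgeEnsemble n) : EdgeEnsemble n :=
  G.map (relabelEdge σ)

/-- The configuration obtained from `p` when each vertex `i` is renamed `σ i`:
the point of the vertex named `σ i` is `p i`. -/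
def relabelConfiguration {d n : ℕ} (σ : Equiv.Perm (Fin n)) (p : Configuration d n) :
    Configuration d n :=
  fun i => p (σ.symm i)

/-- Two configurations are congruent if an isometry of the whole space `ℝ^d` onto itself
(orientation preserving or not) carries one to the other, point by point in order. -/
def IsCongruent {d n : ℕ} (p q : Configuration d n) : Prop :=
  ∃ T : EuclideanSpace ℝ (Fin d) ≃ᵃⁱ[ℝ] EuclideanSpace ℝ (Fin d), ∀ i, T (p i) = q i

end UnlabeledTrilateration

/-!
Why the data determine `G` and `p`.

All of `ℝ` is differentiated: since the coordinates of a generic `p` are algebraically independent,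
every first-order motion of `p` is the action of a derivation of `ℝ` over `ℚ`
(`IsGeneric.exists_derivation`). If an edge `e` has the same length in `p` as `f` has in `q`, a
derivation moves the two squared lengths at the same rate, although nothing is known about `q`. As
the measured edges of `p` are infinitesimally rigid (`inner_eq_zero_of_trilateration`), two things
follow. The measured lengths have the full transcendence degree of the distances of `p`, so `q` is
generic up to congruence (`MatchedTrilateration.distGeneric`); and each stress of measured edges at
`p` is a stress of their partners at `q` (`MatchedTrilateration.sum_smul_rigidityRow_eq_zero`).

This is applied to a complete graph on `d + 2` vertices of `p`. With `α` the affine dependency of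
its points, it carries the stress `α i * α j`, which vanishes on no edge. The partners of its edges
thus carry a nowhere vanishing stress at `q`; by general position each of their vertices has degree
at least `d + 1`, and counting edges shows that they too form a complete graph on `d + 2` vertices
(`exists_eq_offDiag_of_stress`). The stress there is `c * (β k * β l)` with `β` the affine
dependency of the points of `q`, so the bijection of edges matches the products of vertex weights
up to `c`. The weights `α` are free subject to `∑ i, α i = 0` and scale (`IsGeneric.logFree`);
logarithmic derivatives turn this into linear algebra, where the four-cycle relations exhibit the
edge bijection as a sum of vertex potentials. Hence it is induced by a bijection of the vertices,
or it complements edges on four vertices, which the products of weights exclude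
(`LogFree.exists_perm`). So the two complete graphs are congruent
(`MatchedTrilateration.exists_clique`).

Trilateration extends the congruence: a new vertex and `d + 1` earlier neighbours form a complete
graph on `d + 2` vertices all of whose edges have lengths that occur in `q`, since the earlier
points are already located in `q` (`MatchedTrilateration.exists_perm`). Finally `G` and `H` agree
because distinct edges of `p` have distinct lengths.
-/

namespace UnlabeledTrilateration

/-! ### Derivations of a field of characteristic zero -/

section Derivations

variable {K L : Type*} [Field K] [Field L] [Algebra K L] [CharZero K]

open scoped IntermediateField.algebraAdjoinAdjoin TensorProduct in
/-- A field of characteristic zero is formally étale over the polynomial ring generated by a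
transcendence basis, so the partial derivatives extend to the whole field. -/
theorem IsTranscendenceBasis.exists_derivation {ι : Type*} [DecidableEq ι] {x : ι → L}
    (hx : IsTranscendenceBasis K x) (i : ι) :
    ∃ D : Derivation K L L, ∀ j, D (x j) = if j = i then 1 else 0 := by
  let S := Algebra.adjoin K (Set.range x)
  let F := IntermediateField.adjoin K (Set.range x)
  have hL : Algebra.IsAlgebraic F L := hx.isAlgebraic_field
  have h1 : Algebra.FormallyEtale S F := .of_isLocalization (nonZeroDivisors _)
  have h2 : Algebra.FormallyEtale F L := .of_isSeparable _ _
  have h3 : Algebra.FormallyEtale S L := .comp _ F _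
  let e := hx.1.aevalEquiv
  let d : Derivation K S L := Derivation.mk'
    ((Algebra.linearMap S L).restrictScalars K ∘ₗ e.toLinearMap ∘ₗ
      (MvPolynomial.pderiv (R := K) i).toLinearMap ∘ₗ e.symm.toLinearMap) (by
      intro a b
      simp [Algebra.smul_def])
  have hd : ∀ j, d ⟨x j, Algebra.subset_adjoin ⟨j, rfl⟩⟩ = if j = i then 1 else 0 := by
    intro j
    have : (⟨x j, Algebra.subset_adjoin ⟨j, rfl⟩⟩ : S) = e (MvPolynomial.X j) := by
      ext; simp [e]
    rw [this]
    simp only [d, Derivation.coe_mk', LinearMap.comp_apply, AlgEquiv.toLinearMap_apply,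
      AlgEquiv.symm_apply_apply]
    by_cases h : j = i
    · subst h; simp
    · simp [MvPolynomial.pderiv_X_of_ne h, h]
  let f : Ω[L⁄K] →ₗ[L] L := (d.liftKaehlerDifferential.liftBaseChange L) ∘ₗ
    (KaehlerDifferential.tensorKaehlerEquivOfFormallyEtale K S L).symm.toLinearMap
  refine ⟨f.compDer (KaehlerDifferential.D K L), fun j => ?_⟩
  have := KaehlerDifferential.tensorKaehlerEquivOfFormallyEtale_symm_D_algebraMap K S L
    ⟨x j, Algebra.subset_adjoin ⟨j, rfl⟩⟩
  have h4 : (f.compDer (KaehlerDifferential.D K L)) (x j) =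
      f (KaehlerDifferential.D K L (algebraMap S L ⟨x j, Algebra.subset_adjoin ⟨j, rfl⟩⟩)) := rfl
  rw [← hd j, h4]
  simp only [f, LinearMap.comp_apply, LinearEquiv.coe_coe]
  rw [this]
  simp

/-- Derivations take prescribed values on a finite algebraically independent family. -/
theorem AlgebraicIndependent.exists_derivation {ι : Type*} [Fintype ι] {x : ι → L}
    (hx : AlgebraicIndependent K x) (f : ι → L) :
    ∃ D : Derivation K L L, ∀ j, D (x j) = f j := by
  classical
  obtain ⟨t, ht, hb⟩ := exists_isTranscendenceBasis_superset hx.to_subtype_range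
  have key : ∀ i : ι, ∃ D : Derivation K L L, ∀ j, D (x j) = if j = i then 1 else 0 := by
    intro i
    obtain ⟨D, hD⟩ := IsTranscendenceBasis.exists_derivation hb ⟨x i, ht ⟨i, rfl⟩⟩
    refine ⟨D, fun j => ?_⟩
    simpa [hx.injective.eq_iff] using hD ⟨x j, ht ⟨j, rfl⟩⟩
  choose D hD using key
  refine ⟨∑ i, f i • D i, fun j => ?_⟩
  have : ∀ s : Finset ι, (∑ i ∈ s, f i • D i) (x j) = ∑ i ∈ s, (f i • D i) (x j) := by
    intro s
    induction s using Finset.induction_on with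
    | empty => simp
    | insert a s ha ih => rw [Finset.sum_insert ha, Finset.sum_insert ha, Derivation.add_apply, ih]
  rw [this]
  simp [hD]

/-- An element killed by all derivations over `K` is algebraic over `K`. -/
theorem isAlgebraic_of_derivation_eq_zero {y : L} (hy : ∀ D : Derivation K L L, D y = 0) :
    IsAlgebraic K y := by
  by_contra h
  have hx : AlgebraicIndependent K (fun _ : Unit => y) :=
    algebraicIndependent_unique_type_iff.2 h
  obtain ⟨D, hD⟩ := AlgebraicIndependent.exists_derivation hx fun _ => 1
  simpa [hy D] using hD ()

end Derivations

/-! ### Algebraic relations among two families with a common rich subfamily -/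

section Transfer

variable {ι κ : Type*}

/-- Suppose every polynomial relation of `u` is one of `w`, and that `u` and `w` share, up to
reindexing, a finite subfamily over which all of `u` is algebraic. The common subfamily forces
`u` and `w` to have the same transcendence degree, so the specialization `u ↦ w` is injective: the
two families have the same polynomial relations. -/
theorem aeval_eq_zero_of_common_subfamily [Finite κ] {u w : ι → ℝ} {e f : κ → ι}
    (hv : ∀ k, u (e k) = w (f k))
    (huw : ∀ P : MvPolynomial ι ℚ, MvPolynomial.aeval u P = 0 → MvPolynomial.aeval w P = 0)
    (halg : ∀ i, IsAlgebraic (Algebra.adjoin ℚ (Set.range fun k => u (e k))) (u i))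
    {P : MvPolynomial ι ℚ} (hP : MvPolynomial.aeval w P = 0) : MvPolynomial.aeval u P = 0 := by
  classical
  by_contra hne
  let M := AlgebraicIndependent.matroid ℚ ℝ
  set V : Set ℝ := Set.range fun k => u (e k) with hV
  obtain ⟨I, hI⟩ := M.exists_isBasis V
  have hIfin : I.Finite := (Set.finite_range _).subset hI.subset
  have hIU : M.IsBasis I (Set.range u) := by
    refine hI.indep.isBasis_of_subset_of_subset_closure
      (hI.subset.trans (by rintro _ ⟨k, rfl⟩; exact ⟨e k, rfl⟩)) ?_
    rintro _ ⟨i, rfl⟩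
    rw [hI.closure_eq_closure, AlgebraicIndependent.matroid_closure_eq]
    exact halg i
  -- `b a` is the member of `u` whose counterpart in `w` is the basis element `a`
  choose k hk using fun a : I => hI.subset a.2
  let b : I → ℝ := fun a => u (f (k a))
  have hwb : ∀ a, w (f (k a)) = (a : ℝ) := fun a => by rw [← hv]; exact hk a
  have hIind : AlgebraicIndependent ℚ ((↑) : I → ℝ) := hI.indep
  have hren : ∀ R : MvPolynomial I ℚ, MvPolynomial.aeval b R = 0 → R = 0 := by
    intro R hR
    have h1 : MvPolynomial.aeval u (MvPolynomial.rename (fun a => f (k a)) R) = 0 := by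
      rw [MvPolynomial.aeval_rename]; exact hR
    have h2 := huw _ h1
    rw [MvPolynomial.aeval_rename] at h2
    have h3 : w ∘ (fun a => f (k a)) = ((↑) : I → ℝ) := funext hwb
    rw [h3] at h2
    exact (injective_iff_map_eq_zero _).1 hIind R h2
  have hb : AlgebraicIndependent ℚ b := (injective_iff_map_eq_zero _).2 hren
  have hB : M.IsBasis (Set.range b) (Set.range u) := by
    refine Matroid.Indep.isBasis_of_eRk_ge (M := M) hb.to_subtype_range ?_ ?_ ?_ ?_
    · have := hIfin.to_subtype
      exact Set.finite_range b
    · rintro _ ⟨a, rfl⟩; exact ⟨_, rfl⟩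
    · rw [hIU.eRk_eq_encard, Matroid.Indep.eRk_eq_encard (M := M) hb.to_subtype_range,
        ← Set.image_univ, hb.injective.encard_image]
      simp
    · exact Set.subset_univ _
  have hbalg : IsAlgebraic (Algebra.adjoin ℚ (Set.range b)) (MvPolynomial.aeval u P) := by
    rw [AlgebraicIndependent.isAlgebraic_adjoin_iff_of_matroid_isBasis hB]
    have hmem : MvPolynomial.aeval u P ∈ Algebra.adjoin ℚ (Set.range u) := by
      rw [Algebra.adjoin_range_eq_range_aeval]; exact ⟨P, rfl⟩
    exact isAlgebraic_algebraMap
      (⟨MvPolynomial.aeval u P, hmem⟩ : Algebra.adjoin ℚ (Set.range u))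
  obtain ⟨t, ht, r, hr, htr⟩ :=
    hbalg.exists_nonzero_eq_adjoin_mul (mem_nonZeroDivisors_of_ne_zero hne)
  obtain ⟨T, hT⟩ : ∃ T : MvPolynomial ι ℚ, MvPolynomial.aeval u T = t := by
    clear htr
    induction ht using Algebra.adjoin_induction with
    | mem x hx => exact ⟨P, hx.symm⟩
    | algebraMap r =>
      have h1 : (r : ℝ) ∈ Algebra.adjoin ℚ (Set.range u) :=
        Algebra.adjoin_mono (by rintro _ ⟨a, rfl⟩; exact ⟨_, rfl⟩) r.2
      rw [Algebra.adjoin_range_eq_range_aeval] at h1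
      exact h1
    | add x y _ _ hx hy =>
      obtain ⟨X, rfl⟩ := hx
      obtain ⟨Y, rfl⟩ := hy
      exact ⟨X + Y, map_add _ _ _⟩
    | mul x y _ _ hx hy =>
      obtain ⟨X, rfl⟩ := hx
      obtain ⟨Y, rfl⟩ := hy
      exact ⟨X * Y, map_mul _ _ _⟩
  obtain ⟨R, hR⟩ : ∃ R : MvPolynomial I ℚ, MvPolynomial.aeval b R = (r : ℝ) := by
    exact (Algebra.adjoin_range_eq_range_aeval ℚ b).le r.2
  have h1 : MvPolynomial.aeval u (P * T - MvPolynomial.rename (fun a => f (k a)) R) = 0 := by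
    rw [map_sub, map_mul, MvPolynomial.aeval_rename, hT]
    have : MvPolynomial.aeval (u ∘ fun a => f (k a)) R = (r : ℝ) := hR
    rw [this, sub_eq_zero]
    exact htr
  have h2 := huw _ h1
  rw [map_sub, map_mul, hP, zero_mul, zero_sub, neg_eq_zero, MvPolynomial.aeval_rename] at h2
  have h3 : w ∘ (fun a => f (k a)) = ((↑) : I → ℝ) := funext hwb
  rw [h3] at h2
  have h4 : R = 0 := (injective_iff_map_eq_zero _).1 hIind R h2
  rw [h4, map_zero] at hR
  exact hr (Subtype.ext hR.symm)

end Transfer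

/-! ### Genericity up to congruence -/

section DistGeneric

variable {d n : ℕ}

/-- The squared distance of the points `i` and `j` of a configuration, as a function of the
ordered pair `(i, j)`. -/
noncomputable def sqDist (x : Configuration d n) (e : Fin n × Fin n) : ℝ :=
  dist (x e.1) (x e.2) ^ 2

/-- Genericity up to congruence: a polynomial relation with rational coefficients that holds for
the squared distances of `x` holds for those of every configuration. -/
def DistGeneric (x : Configuration d n) : Prop :=
  ∀ P : MvPolynomial (Fin n × Fin n) ℚ, MvPolynomial.aeval (sqDist x) P = 0 →
    ∀ y : Configuration d n, MvPolynomial.aeval (sqDist y) P = 0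

theorem sqDist_swap (x : Configuration d n) (e : Fin n × Fin n) :
    sqDist x e.swap = sqDist x e := by
  simp [sqDist, dist_comm]

theorem sqDist_eq_inner (x : Configuration d n) (i j : Fin n) :
    sqDist x (i, j) = inner ℝ (x i - x j) (x i - x j) := by
  rw [sqDist, dist_eq_norm, real_inner_self_eq_norm_sq]

/-- The coordinates of a configuration as a single family of real numbers. -/
def coords (x : Configuration d n) (ia : Fin n × Fin d) : ℝ := x ia.1 ia.2

/-- The squared distance as a polynomial in the coordinates. -/
noncomputable def sqDistPoly (d : ℕ) {n : ℕ} (e : Fin n × Fin n) :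
    MvPolynomial (Fin n × Fin d) ℚ :=
  ∑ a, (MvPolynomial.X (e.1, a) - MvPolynomial.X (e.2, a)) ^ 2

theorem aeval_sqDistPoly (x : Configuration d n) (e : Fin n × Fin n) :
    MvPolynomial.aeval (coords x) (sqDistPoly d e) = sqDist x e := by
  simp [sqDistPoly, sqDist, EuclideanSpace.dist_eq, Real.sq_sqrt, Finset.sum_nonneg, sq_nonneg,
    coords, Real.dist_eq, sq_abs]

theorem IsGeneric.aeval_eq_zero {p : Configuration d n} (hp : IsGeneric p)
    {Q : MvPolynomial (Fin n × Fin d) ℚ} (hQ : MvPolynomial.aeval (coords p) Q = 0) : Q = 0 :=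
  (injective_iff_map_eq_zero _).1 hp Q hQ

theorem IsGeneric.distGeneric {p : Configuration d n} (hp : IsGeneric p) : DistGeneric p := by
  intro P hP y
  have key : ∀ x : Configuration d n, MvPolynomial.aeval (sqDist x) P =
      MvPolynomial.aeval (coords x) (MvPolynomial.aeval (sqDistPoly d) P) := by
    intro x
    rw [show sqDist x = fun e => MvPolynomial.aeval (coords x) (sqDistPoly d e) from
      funext fun e => (aeval_sqDistPoly x e).symm]
    exact (MvPolynomial.comp_aeval_apply ..).symm
  rw [key] at hP ⊢
  rw [hp.aeval_eq_zero hP, map_zero]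

/-- Distinct edges have distinct lengths in a configuration that is generic up to congruence. -/
theorem DistGeneric.eq_of_sqDist_eq {x : Configuration d n} (hx : DistGeneric x) (hd : 0 < d)
    {i j k l : Fin n} (hij : i ≠ j) (hkl : k ≠ l) (h : sqDist x (i, j) = sqDist x (k, l)) :
    i = k ∧ j = l ∨ i = l ∧ j = k := by
  -- a configuration with one point away from all the others separates two distinct edges
  have key : ∀ w : Fin n, ((i = w ∨ j = w) ↔ (k = w ∨ l = w)) := by
    intro w
    let y : Configuration d n := Pi.single w (EuclideanSpace.single ⟨0, hd⟩ 1)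
    have hy := hx (MvPolynomial.X (i, j) - MvPolynomial.X (k, l)) (by simp [h]) y
    have hval : ∀ a b : Fin n, a ≠ b → sqDist y (a, b) = if a = w ∨ b = w then 1 else 0 := by
      intro a b hab
      by_cases ha : a = w
      · subst ha
        simp [sqDist, y, hab.symm]
      · by_cases hb : b = w
        · subst hb
          simp [sqDist, y, ha]
        · simp [sqDist, y, ha, hb]
    simp only [map_sub, MvPolynomial.aeval_X, hval i j hij, hval k l hkl] at hy
    split_ifs at hy with h1 h2 h2
    · exact ⟨fun _ => h2, fun _ => h1⟩
    · norm_num at hy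
    · norm_num at hy
    · exact ⟨fun h => absurd h h1, fun h => absurd h h2⟩
  have h1 := key i
  have h2 := key j
  simp only [true_or, or_true, true_iff] at h1 h2
  grind

/-- General position: an affine dependency of a configuration that is generic up to congruence
involves at least `d + 2` points. -/
theorem DistGeneric.eq_zero_of_affine_dependency {x : Configuration d n} (hx : DistGeneric x)
    (hn : d + 1 ≤ n) {c : Fin n → ℝ} {S : Finset (Fin n)} (hS : S.card ≤ d + 1)
    (hcS : ∀ i, i ∉ S → c i = 0) (hc : ∑ i, c i = 0) (hcx : ∑ i, c i • x i = 0) : c = 0 := by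
  obtain ⟨T, hST, hT⟩ := Finset.exists_superset_card_eq hS (by simpa using hn)
  obtain ⟨w, hw⟩ : T.Nonempty := by rw [← Finset.card_pos]; omega
  have hcT : ∀ i, i ∉ T → c i = 0 := fun i hi => hcS i fun h => hi (hST h)
  -- the Gram matrix of the vectors `x i - x w` is a polynomial in the squared distances
  let U := T.erase w
  have hU : Fintype.card U = d := by
    rw [Fintype.card_coe, Finset.card_erase_of_mem hw, hT]; rfl
  let g : Matrix U U (MvPolynomial (Fin n × Fin n) ℚ) := Matrix.of fun i j =>
    MvPolynomial.C (1 / 2) * (MvPolynomial.X (i.1, w) + MvPolynomial.X (j.1, w) -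
      MvPolynomial.X (i.1, j.1))
  have hg : ∀ y : Configuration d n, MvPolynomial.aeval (sqDist y) g.det =
      (Matrix.gram ℝ fun i : U => y i - y w).det := by
    intro y
    rw [AlgHom.map_det]
    congr 1
    ext i j
    have h1 : y i.1 - y j.1 = (y i.1 - y w) - (y j.1 - y w) := by abel
    rw [AlgHom.mapMatrix_apply, Matrix.map_apply, Matrix.gram_apply]
    simp only [g, Matrix.of_apply, map_mul, map_sub, map_add, MvPolynomial.aeval_X,
      sqDist_eq_inner, MvPolynomial.algHom_C]
    rw [h1, real_inner_sub_sub_self (y i.1 - y w) (y j.1 - y w), eq_ratCast]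
    push_cast
    ring
  have hli : LinearIndependent ℝ fun i : U => x i - x w := by
    rw [← Matrix.det_gram_ne_zero_iff_linearIndependent, ← hg]
    intro h0
    let e : U ≃ Fin d := Fintype.equivFinOfCardEq hU
    let y : Configuration d n := fun i =>
      if h : i ∈ U then EuclideanSpace.single (e ⟨i, h⟩) 1 else 0
    have h1 := hx _ h0 y
    rw [hg] at h1
    refine (Matrix.det_gram_ne_zero_iff_linearIndependent (𝕜 := ℝ)).2 ?_ h1
    have h2 : (fun i : U => y i - y w) = (EuclideanSpace.basisFun (Fin d) ℝ) ∘ e := by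
      funext i
      have hwU : w ∉ U := by simp [U]
      simp [y, i.2, hwU]
    rw [h2]
    exact (EuclideanSpace.basisFun (Fin d) ℝ).orthonormal.linearIndependent.comp _ e.injective
  have hsum : ∑ i : U, c i • (x i - x w) = 0 := by
    rw [Finset.sum_coe_sort U fun i => c i • (x i - x w)]
    have h1 : ∑ i ∈ U, c i • (x i - x w) = ∑ i, c i • (x i - x w) := by
      refine Finset.sum_subset (Finset.subset_univ _) fun i _ hi => ?_
      by_cases hiw : i = w
      · simp [hiw]
      · rw [hcT i fun h => hi (Finset.mem_erase.2 ⟨hiw, h⟩), zero_smul]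
    rw [h1]
    simp only [smul_sub, Finset.sum_sub_distrib, hcx, ← Finset.sum_smul, hc, zero_smul, sub_zero]
  have hcU : ∀ i, i ≠ w → c i = 0 := by
    intro i hiw
    by_cases hi : i ∈ U
    · exact Fintype.linearIndependent_iff.1 hli (fun i => c i) hsum ⟨i, hi⟩
    · exact hcT i fun h => hi (Finset.mem_erase.2 ⟨hiw, h⟩)
  funext i
  by_cases hiw : i = w
  · rw [hiw, Pi.zero_apply, ← hc]
    exact (Finset.sum_eq_single w (fun j _ hj => hcU j hj) (by simp)).symm
  · exact hcU i hiw

/-- General position for an injective family of vertices. -/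
theorem DistGeneric.eq_zero_of_dependency {x : Configuration d n} (hx : DistGeneric x)
    (hn : d + 1 ≤ n) {ι : Type*} [Fintype ι] {r : ι → Fin n} (hr : Function.Injective r)
    {w : ι → ℝ} {S : Finset ι} (hS : S.card ≤ d + 1) (hwS : ∀ k, k ∉ S → w k = 0)
    (hw : ∑ k, w k = 0) (hwx : ∑ k, w k • x (r k) = 0) : w = 0 := by
  classical
  funext k
  let c : Fin n → ℝ := fun i => ∑ k, if r k = i then w k else 0
  have h0 : c = 0 := by
    refine hx.eq_zero_of_affine_dependency hn (S := S.image r) ?_ ?_ ?_ ?_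
    · exact Finset.card_image_le.trans hS
    · intro i hi
      refine Finset.sum_eq_zero fun k _ => ?_
      split_ifs with h
      · exact hwS k fun hk => hi (Finset.mem_image.2 ⟨k, hk, h⟩)
      · rfl
    · simp only [c]
      rw [Finset.sum_comm]
      simpa using hw
    · simp only [c, Finset.sum_smul, ite_smul, zero_smul]
      rw [Finset.sum_comm]
      simpa using hwx
  have h1 : c (r k) = w k := by simp [c, hr.eq_iff]
  rw [← h1, h0, Pi.zero_apply, Pi.zero_apply]

theorem DistGeneric.affineIndependent {x : Configuration d n} (hx : DistGeneric x)
    (hn : d + 1 ≤ n) {r : Fin (d + 1) → Fin n} (hr : Function.Injective r) :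
    AffineIndependent ℝ fun k => x (r k) := by
  rw [affineIndependent_iff_of_fintype]
  intro w hw hwx k
  rw [Finset.weightedVSub_eq_linear_combination _ hw] at hwx
  rw [hx.eq_zero_of_dependency hn hr (S := Finset.univ) (by simp) (by simp) hw hwx, Pi.zero_apply]

/-- Any `d + 2` points of a configuration that is generic up to congruence have exactly one affine
dependency up to scale, and none of its coefficients vanishes. -/
theorem DistGeneric.exists_affine_dependency {x : Configuration d n} (hx : DistGeneric x)
    (hn : d + 1 ≤ n) {r : Fin (d + 2) → Fin n} (hr : Function.Injective r) :
    ∃ α : Fin (d + 2) → ℝ, (∀ k, α k ≠ 0) ∧ ∑ k, α k = 0 ∧ ∑ k, α k • x (r k) = 0 ∧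
      ∀ γ : Fin (d + 2) → ℝ, ∑ k, γ k = 0 → ∑ k, γ k • x (r k) = 0 → ∃ κ : ℝ, γ = κ • α := by
  have hzero : ∀ γ : Fin (d + 2) → ℝ, ∑ k, γ k = 0 → ∑ k, γ k • x (r k) = 0 →
      ∀ k, γ k = 0 → γ = 0 := by
    intro γ h1 h2 k hk
    refine hx.eq_zero_of_dependency hn hr (S := Finset.univ.erase k) (by simp) ?_ h1 h2
    intro l hl
    have : l = k := by simpa using hl
    rwa [this]
  have hdep : ¬ AffineIndependent ℝ fun k => x (r k) := fun h => by
    have h1 := h.card_le_finrank_succ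
    have h2 := Submodule.finrank_le (vectorSpan ℝ (Set.range fun k => x (r k)))
    simp at h1 h2
    omega
  rw [affineIndependent_iff_of_fintype] at hdep
  push Not at hdep
  obtain ⟨α, hα, hαx, k, hk⟩ := hdep
  rw [Finset.weightedVSub_eq_linear_combination _ hα] at hαx
  have hne : ∀ k, α k ≠ 0 := fun l hl => hk (by rw [hzero α hα hαx l hl, Pi.zero_apply])
  refine ⟨α, hne, hα, hαx, fun γ h1 h2 => ⟨γ 0 / α 0, ?_⟩⟩
  rw [← sub_eq_zero]
  refine hzero _ ?_ ?_ 0 ?_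
  · simp [Finset.sum_sub_distrib, h1, ← Finset.mul_sum, hα]
  · simp [sub_smul, Finset.sum_sub_distrib, h2, mul_smul, ← Finset.smul_sum, hαx]
  · simp [div_mul_cancel₀ _ (hne 0)]

end DistGeneric

/-! ### Motions and isometries determined by a simplex -/

section Simplex

variable {d : ℕ} {a : Fin (d + 1) → EuclideanSpace ℝ (Fin d)}

/-- The basis of edge vectors at the initial vertex of a nondegenerate simplex. -/
noncomputable def simplexBasis (ha : AffineIndependent ℝ a) :
    Module.Basis (Fin d) ℝ (EuclideanSpace ℝ (Fin d)) :=
  basisOfLinearIndependentOfCardEqFinrank' (fun k => a k.succ - a 0)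
    (((affineIndependent_iff_linearIndependent_vsub ℝ a 0).1 ha).comp
      (fun k : Fin d => ⟨k.succ, Fin.succ_ne_zero k⟩) fun _ _ h => by simpa using h) (by simp)

@[simp]
theorem simplexBasis_apply (ha : AffineIndependent ℝ a) (k : Fin d) :
    simplexBasis ha k = a k.succ - a 0 := by
  simp [simplexBasis]

theorem eq_zero_of_inner_simplex (ha : AffineIndependent ℝ a) {y : EuclideanSpace ℝ (Fin d)}
    (hy : ∀ k, inner ℝ (a k - a 0) y = 0) : y = 0 := by
  have h1 : innerₗ (EuclideanSpace ℝ (Fin d)) y = 0 :=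
    (simplexBasis ha).ext fun k => by
      rw [simplexBasis_apply, innerₗ_apply_apply, real_inner_comm]
      exact hy k.succ
  exact inner_self_eq_zero.1 (LinearMap.congr_fun h1 y)

/-- A point is determined by its distances to the vertices of a nondegenerate simplex. -/
theorem eq_of_dist_simplex_eq (ha : AffineIndependent ℝ a) {x y : EuclideanSpace ℝ (Fin d)}
    (h : ∀ k, dist x (a k) = dist y (a k)) : x = y := by
  rw [← sub_eq_zero]
  refine eq_zero_of_inner_simplex ha fun k => ?_
  have key : ∀ z, inner ℝ (a k - a 0) z =
      (dist z (a 0) ^ 2 - dist z (a k) ^ 2 + ‖a k‖ ^ 2 - ‖a 0‖ ^ 2) / 2 := by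
    intro z
    rw [dist_eq_norm, dist_eq_norm, norm_sub_sq_real, norm_sub_sq_real, inner_sub_left,
      real_inner_comm z, real_inner_comm z]
    ring
  rw [inner_sub_right, key, key, h, h, sub_self]

/-- A first-order motion of a nondegenerate simplex that preserves its edge lengths to first order
is the restriction of an infinitesimal isometry. -/
theorem exists_skew_of_simplex (ha : AffineIndependent ℝ a)
    {a' : Fin (d + 1) → EuclideanSpace ℝ (Fin d)}
    (h : ∀ k l, inner ℝ (a k - a l) (a' k - a' l) = 0) :
    ∃ (A : EuclideanSpace ℝ (Fin d) →ₗ[ℝ] EuclideanSpace ℝ (Fin d))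
      (b : EuclideanSpace ℝ (Fin d)), (∀ x, inner ℝ x (A x) = 0) ∧ ∀ k, a' k = A (a k) + b := by
  let v := simplexBasis ha
  let A := v.constr ℝ fun k : Fin d => a' k.succ - a' 0
  have hA : ∀ k, A (a k - a 0) = a' k - a' 0 := by
    intro k
    refine Fin.cases (by simp) (fun k => ?_) k
    rw [← simplexBasis_apply ha, Module.Basis.constr_basis]
  have hB : ∀ k l, inner ℝ (v k) (A (v l)) + inner ℝ (A (v k)) (v l) = 0 := by
    intro k l
    simp only [v, simplexBasis_apply, hA]
    have h1 := h k.succ l.succ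
    have h2 := h k.succ 0
    have h3 := h l.succ 0
    have e : ∀ x y u w : EuclideanSpace ℝ (Fin d), inner ℝ (x - y) (u - w) =
        inner ℝ x u - inner ℝ x w - inner ℝ y u + inner ℝ y w := by
      intro x y u w
      rw [inner_sub_left, inner_sub_right, inner_sub_right]
      ring
    rw [← sub_sub_sub_cancel_right (a k.succ) (a l.succ) (a 0),
      ← sub_sub_sub_cancel_right (a' k.succ) (a' l.succ) (a' 0), e, h2, h3] at h1
    rw [real_inner_comm (a l.succ - a 0) (a' k.succ - a' 0)]
    linarith
  let B : EuclideanSpace ℝ (Fin d) →ₗ[ℝ] EuclideanSpace ℝ (Fin d) →ₗ[ℝ] ℝ :=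
    (innerₗ _).compl₂ A + (innerₗ _).comp A
  have hB0 : B = 0 := v.ext fun k => v.ext fun l => hB k l
  refine ⟨A, a' 0 - A (a 0), fun x => ?_, fun k => ?_⟩
  · have h1 : inner ℝ x (A x) + inner ℝ (A x) x = 0 := LinearMap.congr_fun₂ hB0 x x
    rw [real_inner_comm x (A x)] at h1
    linarith
  · have h1 := hA k
    rw [map_sub] at h1
    rw [← sub_add_cancel (a' k) (a' 0), ← h1]
    abel

/-- A map of the vertices of a nondegenerate simplex that preserves distances extends to an
isometry of the whole space. -/
theorem exists_affineIsometryEquiv_of_simplex (ha : AffineIndependent ℝ a)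
    {b : Fin (d + 1) → EuclideanSpace ℝ (Fin d)} (h : ∀ k l, dist (a k) (a l) = dist (b k) (b l)) :
    ∃ T : EuclideanSpace ℝ (Fin d) ≃ᵃⁱ[ℝ] EuclideanSpace ℝ (Fin d), ∀ k, T (a k) = b k := by
  let v := simplexBasis ha
  let A := v.constr ℝ fun k : Fin d => b k.succ - b 0
  have hA : ∀ k, A (a k - a 0) = b k - b 0 := by
    intro k
    refine Fin.cases (by simp) (fun k => ?_) k
    rw [← simplexBasis_apply ha, Module.Basis.constr_basis]
  let B : EuclideanSpace ℝ (Fin d) →ₗ[ℝ] EuclideanSpace ℝ (Fin d) →ₗ[ℝ] ℝ :=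
    ((innerₗ _).compl₂ A).comp A - innerₗ _
  have hB0 : B = 0 := by
    refine v.ext fun k => v.ext fun l => ?_
    change inner ℝ (A (v k)) (A (v l)) - inner ℝ (v k) (v l) = 0
    simp only [v, simplexBasis_apply, hA]
    have key : ∀ c : Fin (d + 1) → EuclideanSpace ℝ (Fin d),
        inner ℝ (c k.succ - c 0) (c l.succ - c 0) = (dist (c k.succ) (c 0) ^ 2 +
          dist (c l.succ) (c 0) ^ 2 - dist (c k.succ) (c l.succ) ^ 2) / 2 := by
      intro c
      rw [dist_eq_norm, dist_eq_norm, dist_eq_norm,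
        ← sub_sub_sub_cancel_right (c k.succ) (c l.succ) (c 0), norm_sub_sq_real (c k.succ - c 0)]
      ring
    rw [key, key, h, h, h, sub_self]
  have hiso : ∀ x, ‖A x‖ = ‖x‖ := by
    intro x
    have h1 : inner ℝ (A x) (A x) - inner ℝ x x = 0 := LinearMap.congr_fun₂ hB0 x x
    rw [real_inner_self_eq_norm_sq, real_inner_self_eq_norm_sq, sub_eq_zero] at h1
    exact (sq_eq_sq₀ (norm_nonneg _) (norm_nonneg _)).1 h1
  let A' := LinearIsometry.toLinearIsometryEquiv ⟨A, hiso⟩ rfl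
  refine ⟨AffineIsometryEquiv.mk' (fun x => A' (x - a 0) + b 0) A' (a 0) fun x => by simp,
    fun k => ?_⟩
  have h1 : A' (a k - a 0) = b k - b 0 := hA k
  rw [AffineIsometryEquiv.coe_mk', h1, sub_add_cancel]

end Simplex

/-! ### Infinitesimal rigidity and derivations -/

section Rigidity

variable {d n : ℕ}

/-- The row of the rigidity matrix of `x` indexed by the ordered pair `e`: half the differential
of the squared distance. -/
noncomputable def rigidityRow (x : Configuration d n) (e : Fin n × Fin n) :
    Configuration d n →ₗ[ℝ] ℝ where
  toFun x' := inner ℝ (x e.1 - x e.2) (x' e.1 - x' e.2)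
  map_add' u v := by simp [inner_add_right, inner_sub_right]; ring
  map_smul' c u := by simp [inner_smul_right, inner_sub_right]; ring

@[simp]
theorem rigidityRow_apply (x x' : Configuration d n) (e : Fin n × Fin n) :
    rigidityRow x e x' = inner ℝ (x e.1 - x e.2) (x' e.1 - x' e.2) := rfl

/-- The coordinatewise action of a derivation on vectors. -/
noncomputable def derivVec (D : Derivation ℚ ℝ ℝ) :
    EuclideanSpace ℝ (Fin d) →+ EuclideanSpace ℝ (Fin d) where
  toFun v := WithLp.toLp 2 fun a => D (v a)
  map_zero' := by ext; simp
  map_add' u v := by ext; simp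

@[simp]
theorem derivVec_apply (D : Derivation ℚ ℝ ℝ) (v : EuclideanSpace ℝ (Fin d)) (a : Fin d) :
    derivVec D v a = D (v a) := rfl

theorem derivVec_smul (D : Derivation ℚ ℝ ℝ) (c : ℝ) (v : EuclideanSpace ℝ (Fin d)) :
    derivVec D (c • v) = D c • v + c • derivVec D v := by
  ext a
  simp
  ring

theorem derivation_inner_self (D : Derivation ℚ ℝ ℝ) (v : EuclideanSpace ℝ (Fin d)) :
    D (inner ℝ v v) = 2 * inner ℝ v (derivVec D v) := by
  simp only [PiLp.inner_apply, map_sum, Finset.mul_sum, derivVec_apply]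
  refine Finset.sum_congr rfl fun a _ => ?_
  simp
  ring

theorem derivation_sqDist (D : Derivation ℚ ℝ ℝ) (x : Configuration d n) (e : Fin n × Fin n) :
    D (sqDist x e) = 2 * rigidityRow x e fun i => derivVec D (x i) := by
  rw [show sqDist x e = _ from sqDist_eq_inner x e.1 e.2, derivation_inner_self, map_sub]
  rfl

/-- A generic configuration can be moved by a derivation in any direction. -/
theorem IsGeneric.exists_derivation {p : Configuration d n} (hp : IsGeneric p)
    (p' : Configuration d n) :
    ∃ D : Derivation ℚ ℝ ℝ, (fun i => derivVec D (p i)) = p' := by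
  obtain ⟨D, hD⟩ := AlgebraicIndependent.exists_derivation hp fun ij => p' ij.1 ij.2
  exact ⟨D, funext fun i => by ext a; exact hD (i, a)⟩

/-- A trilateration is infinitesimally rigid: first-order motions that preserve the lengths of its
edges preserve all distances. -/
theorem inner_eq_zero_of_trilateration {x x' : Configuration d n} (hn : d + 2 ≤ n)
    (hx : ∀ r : Fin (d + 1) → Fin n, Function.Injective r → AffineIndependent ℝ fun k => x (r k))
    {R : Fin n → Fin n → Prop} (π : Equiv.Perm (Fin n))
    (hbase : ∀ i j : Fin n, (i : ℕ) < d + 2 → (j : ℕ) < d + 2 → i ≠ j → R (π i) (π j))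
    (hstep : ∀ j : Fin n, d + 2 ≤ (j : ℕ) →
      ∃ r : Fin (d + 1) ↪ Fin n, ∀ k, r k < j ∧ R (π (r k)) (π j))
    (h : ∀ i j, R i j → inner ℝ (x i - x j) (x' i - x' j) = 0) (i j : Fin n) :
    inner ℝ (x i - x j) (x' i - x' j) = 0 := by
  let c : Fin (d + 1) ↪ Fin n := Fin.castLEEmb (by omega)
  have hc : ∀ k, (c k : ℕ) = k := fun k => rfl
  have hinj : ∀ r : Fin (d + 1) ↪ Fin n, Function.Injective fun k => π (r k) :=
    fun r => π.injective.comp r.injective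
  obtain ⟨A, b, hA, hAb⟩ := exists_skew_of_simplex (hx _ (hinj c))
    (a' := fun k => x' (π (c k))) (by
      intro k l
      by_cases hkl : k = l
      · simp [hkl]
      · exact h _ _ (hbase _ _ (by rw [hc]; omega) (by rw [hc]; omega)
          fun he => hkl (c.injective he)))
  have key : ∀ m : ℕ, ∀ j : Fin n, (j : ℕ) = m → x' (π j) = A (x (π j)) + b := by
    intro m
    induction m using Nat.strong_induction_on with
    | _ m ih =>
      intro j hj
      by_cases hjd : (j : ℕ) < d + 1
      · exact hAb ⟨j, hjd⟩
      obtain ⟨r, hr⟩ : ∃ r : Fin (d + 1) ↪ Fin n, ∀ k, r k < j ∧ R (π (r k)) (π j) := by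
        by_cases hjd' : d + 2 ≤ (j : ℕ)
        · exact hstep j hjd'
        · refine ⟨c, fun k => ?_⟩
          have hlt : c k < j := by rw [Fin.lt_def, hc]; omega
          exact ⟨hlt, hbase _ _ (by rw [hc]; omega) (by omega) hlt.ne⟩
      have h1 : ∀ k, inner ℝ (x (π (r k)) - x (π j)) (x' (π j) - A (x (π j)) - b) = 0 := by
        intro k
        have h2 := h _ _ (hr k).2
        rw [ih (r k) (by rw [← hj]; exact (hr k).1) (r k) rfl] at h2
        have h3 := hA (x (π (r k)) - x (π j))
        rw [map_sub] at h3
        have h4 : x' (π j) - A (x (π j)) - b = (A (x (π (r k))) - A (x (π j))) -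
          (A (x (π (r k))) + b - x' (π j)) := by abel
        rw [h4, inner_sub_right, h2, h3, sub_zero]
      have h2 := eq_zero_of_inner_simplex (hx _ (hinj r))
        (y := x' (π j) - A (x (π j)) - b) (by
          intro k
          rw [← sub_sub_sub_cancel_right _ _ (x (π j)), inner_sub_left, h1, h1, sub_zero])
      rw [sub_sub, sub_eq_zero] at h2
      exact h2
  have key' : ∀ i, x' i = A (x i) + b := fun i => by
    have := key _ (π.symm i) rfl
    rwa [Equiv.apply_symm_apply] at this
  rw [key', key', add_sub_add_right_eq_sub, ← map_sub]
  exact hA _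

open scoped IntermediateField.algebraAdjoinAdjoin in
/-- If every derivation that kills the family `v` kills `y`, then `y` is algebraic over `ℚ[v]`. -/
theorem isAlgebraic_adjoin_of_derivation {y : ℝ} {s : Set ℝ}
    (h : ∀ D : Derivation ℚ ℝ ℝ, (∀ v ∈ s, D v = 0) → D y = 0) :
    IsAlgebraic (Algebra.adjoin ℚ s) y := by
  let F := IntermediateField.adjoin ℚ s
  rw [IsFractionRing.isAlgebraic_iff (Algebra.adjoin ℚ s) F ℝ]
  refine isAlgebraic_of_derivation_eq_zero fun D => h (D.restrictScalars ℚ) fun v hv => ?_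
  exact D.map_algebraMap (⟨v, IntermediateField.subset_adjoin ℚ s hv⟩ : F)

end Rigidity

/-! ### Transport of stresses -/

section Stress

variable {d n : ℕ}

/-- The row `rigidityRow x e` as a vector of coordinates. -/
noncomputable def rowVec (x : Configuration d n) (e : Fin n × Fin n) :
    EuclideanSpace ℝ (Fin n × Fin d) :=
  WithLp.toLp 2 fun ia => ((if ia.1 = e.1 then 1 else 0) - if ia.1 = e.2 then 1 else 0) *
    (x e.1 ia.2 - x e.2 ia.2)

/-- The functional on configurations given by a vector of coordinates. -/
noncomputable def coordFunctional (d n : ℕ) :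
    EuclideanSpace ℝ (Fin n × Fin d) →ₗ[ℝ] Configuration d n →ₗ[ℝ] ℝ :=
  LinearMap.mk₂ ℝ (fun v x' => ∑ ia, v ia * x' ia.1 ia.2)
    (fun u v x' => by simp [add_mul, Finset.sum_add_distrib])
    (fun c v x' => by simp [mul_assoc, Finset.mul_sum])
    (fun v x' y' => by simp [mul_add, Finset.sum_add_distrib])
    (fun c v x' => by simp [mul_left_comm, Finset.mul_sum])

theorem coordFunctional_apply (v : EuclideanSpace ℝ (Fin n × Fin d)) (x' : Configuration d n) :
    coordFunctional d n v x' = ∑ ia, v ia * x' ia.1 ia.2 := rfl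

theorem ker_coordFunctional : LinearMap.ker (coordFunctional d n) = ⊥ := by
  rw [LinearMap.ker_eq_bot']
  intro v hv
  ext ia
  have h1 := LinearMap.congr_fun hv (Pi.single ia.1 (EuclideanSpace.single ia.2 1))
  rw [coordFunctional_apply, Finset.sum_eq_single ia] at h1
  · simpa using h1
  · intro jb _ hne
    by_cases h2 : jb.1 = ia.1
    · have h3 : jb.2 ≠ ia.2 := fun h3 => hne (Prod.ext h2 h3)
      simp [h2, h3]
    · simp [h2]
  · simp

theorem coordFunctional_rowVec (x : Configuration d n) (e : Fin n × Fin n) :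
    coordFunctional d n (rowVec x e) = rigidityRow x e := by
  refine LinearMap.ext fun x' => ?_
  rw [coordFunctional_apply, rigidityRow_apply, Fintype.sum_prod_type_right]
  simp only [rowVec, PiLp.inner_apply]
  refine Finset.sum_congr rfl fun a _ => ?_
  simp only [sub_mul, Finset.sum_sub_distrib, ite_mul, one_mul, zero_mul, Finset.sum_ite_eq',
    Finset.mem_univ, if_true]
  simp
  ring

/-- The rigidity matroid of a generic configuration is the freest possible: rows of the rigidity
matrix that are independent for some configuration are independent for a generic one, because
their Gram determinant is a polynomial in the coordinates. -/
theorem IsGeneric.linearIndependent_rigidityRow {p x : Configuration d n} (hp : IsGeneric p)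
    {ι : Type*} [Fintype ι] {e : ι → Fin n × Fin n}
    (h : LinearIndependent ℝ fun i => rigidityRow x (e i)) :
    LinearIndependent ℝ fun i => rigidityRow p (e i) := by
  classical
  have key : ∀ y : Configuration d n, (LinearIndependent ℝ fun i => rigidityRow y (e i)) ↔
      LinearIndependent ℝ fun i => rowVec y (e i) := by
    intro y
    simp only [← coordFunctional_rowVec]
    exact LinearMap.linearIndependent_iff _ ker_coordFunctional
  rw [key, ← Matrix.det_gram_ne_zero_iff_linearIndependent] at h ⊢
  let r : ι → Fin n × Fin d → MvPolynomial (Fin n × Fin d) ℚ := fun i ia =>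
    ((if ia.1 = (e i).1 then 1 else 0) - if ia.1 = (e i).2 then 1 else 0) *
      (MvPolynomial.X ((e i).1, ia.2) - MvPolynomial.X ((e i).2, ia.2))
  have hr : ∀ (y : Configuration d n) i ia,
      MvPolynomial.aeval (coords y) (r i ia) = rowVec y (e i) ia := by
    intro y i ia
    simp only [r, rowVec, map_mul, map_sub, MvPolynomial.aeval_X]
    simp [apply_ite (MvPolynomial.aeval (coords y)), coords]
  let g : Matrix ι ι (MvPolynomial (Fin n × Fin d) ℚ) := Matrix.of fun i j =>
    ∑ ia, r i ia * r j ia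
  have hg : ∀ y : Configuration d n, MvPolynomial.aeval (coords y) g.det =
      (Matrix.gram ℝ fun i => rowVec y (e i)).det := by
    intro y
    rw [AlgHom.map_det]
    congr 1
    ext i j
    rw [AlgHom.mapMatrix_apply, Matrix.map_apply, Matrix.gram_apply]
    simp [g, hr, PiLp.inner_apply, mul_comm]
  intro h0
  rw [← hg] at h0 h
  rw [hp.aeval_eq_zero h0, map_zero] at h
  exact h rfl

theorem IsGeneric.finrank_span_rigidityRow_le {p : Configuration d n} (hp : IsGeneric p)
    (x : Configuration d n) :
    Module.finrank ℝ (Submodule.span ℝ (Set.range (rigidityRow x))) ≤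
      Module.finrank ℝ (Submodule.span ℝ (Set.range (rigidityRow p))) := by
  obtain ⟨f, hf, -, hli⟩ := Submodule.exists_fun_fin_finrank_span_eq ℝ (Set.range (rigidityRow x))
  choose e he using hf
  have h1 := hp.linearIndependent_rigidityRow (e := e) (x := x) (by simpa only [he] using hli)
  have h2 := finrank_span_eq_card h1
  rw [Fintype.card_fin] at h2
  rw [← h2]
  exact Submodule.finrank_mono (Submodule.span_mono (by rintro _ ⟨i, rfl⟩; exact ⟨_, rfl⟩))

/-- The pair `i, j` is an edge whose length in `p` occurs as a distance of `q`. -/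
def IsMatched (p q : Configuration d n) (i j : Fin n) : Prop :=
  i ≠ j ∧ ∃ f, sqDist p (i, j) = sqDist q f

/-- The matched edges allow for trilateration in the order given by `π`. -/
structure MatchedTrilateration (p q : Configuration d n) (π : Equiv.Perm (Fin n)) : Prop where
  base : ∀ i j : Fin n, (i : ℕ) < d + 2 → (j : ℕ) < d + 2 → i ≠ j → IsMatched p q (π i) (π j)
  step : ∀ j : Fin n, d + 2 ≤ (j : ℕ) →
    ∃ r : Fin (d + 1) ↪ Fin n, ∀ k, r k < j ∧ IsMatched p q (π (r k)) (π j)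

variable {p q : Configuration d n} {π : Equiv.Perm (Fin n)}

theorem MatchedTrilateration.rigidityRow_eq_zero (h : MatchedTrilateration p q π)
    (hp : IsGeneric p) (hn : d + 2 ≤ n) {p' : Configuration d n}
    (hp' : ∀ e f, sqDist p e = sqDist q f → rigidityRow p e p' = 0) (e : Fin n × Fin n) :
    rigidityRow p e p' = 0 :=
  inner_eq_zero_of_trilateration hn
    (fun _ hr => hp.distGeneric.affineIndependent (by omega) hr) π h.base h.step
    (fun i j hij => by
      obtain ⟨-, f, hf⟩ := hij
      exact hp' _ f hf) e.1 e.2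

/-- The matched lengths have the full transcendence degree of the distances of `p`, which makes
`q` generic up to congruence. -/
theorem MatchedTrilateration.distGeneric (h : MatchedTrilateration p q π) (hp : IsGeneric p)
    (hn : d + 2 ≤ n) : DistGeneric q := by
  intro P hP
  refine hp.distGeneric P (aeval_eq_zero_of_common_subfamily
    (κ := {ef : (Fin n × Fin n) × (Fin n × Fin n) // sqDist p ef.1 = sqDist q ef.2})
    (e := fun k => k.1.1) (f := fun k => k.1.2) (fun k => k.2)
    (fun Q hQ => hp.distGeneric Q hQ q) (fun e => ?_) hP)
  refine isAlgebraic_adjoin_of_derivation fun D hD => ?_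
  rw [derivation_sqDist, h.rigidityRow_eq_zero hp hn, mul_zero]
  intro e f hef
  have h1 := hD _ ⟨⟨(e, f), hef⟩, rfl⟩
  simpa [derivation_sqDist] using h1

/-- A stress of matched edges at `p` is a stress of their partners at `q`. Conversely a stress at
`q` is one at `p`, since the two edges of a matched pair have the same derivative under every
derivation; and the stress space at `q` is at least as large because `p` is generic. -/
theorem MatchedTrilateration.sum_smul_rigidityRow_eq_zero (h : MatchedTrilateration p q π)
    (hp : IsGeneric p) (hn : d + 2 ≤ n) {ι : Type*} [Fintype ι] {e f : ι → Fin n × Fin n}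
    (hef : ∀ i, sqDist p (e i) = sqDist q (f i)) {ω : ι → ℝ}
    (hω : ∑ i, ω i • rigidityRow p (e i) = 0) : ∑ i, ω i • rigidityRow q (f i) = 0 := by
  classical
  let κ := {ef : (Fin n × Fin n) × (Fin n × Fin n) // sqDist p ef.1 = sqDist q ef.2}
  let a : κ → Configuration d n →ₗ[ℝ] ℝ := fun k => rigidityRow p k.1.1
  let b : κ → Configuration d n →ₗ[ℝ] ℝ := fun k => rigidityRow q k.1.2
  have hle : LinearMap.ker (Fintype.linearCombination ℝ b) ≤
      LinearMap.ker (Fintype.linearCombination ℝ a) := by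
    intro w hw
    rw [LinearMap.mem_ker, Fintype.linearCombination_apply] at hw ⊢
    refine LinearMap.ext fun p' => ?_
    obtain ⟨D, rfl⟩ := hp.exists_derivation p'
    have h1 : ∀ k : κ, a k (fun i => derivVec D (p i)) = b k (fun i => derivVec D (q i)) := by
      intro k
      have h2 := congrArg D k.2
      rw [derivation_sqDist, derivation_sqDist] at h2
      exact mul_left_cancel₀ two_ne_zero h2
    have h2 := LinearMap.congr_fun hw fun i => derivVec D (q i)
    simpa only [LinearMap.sum_apply, LinearMap.smul_apply, h1, LinearMap.zero_apply] using h2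
  have hspan : Submodule.span ℝ (Set.range a) = Submodule.span ℝ (Set.range (rigidityRow p)) := by
    refine le_antisymm (Submodule.span_mono (by rintro _ ⟨k, rfl⟩; exact ⟨_, rfl⟩)) ?_
    rw [Submodule.span_le]
    rintro _ ⟨e, rfl⟩
    refine mem_span_of_iInf_ker_le_ker fun p' hp' => ?_
    rw [Submodule.mem_iInf] at hp'
    exact h.rigidityRow_eq_zero hp hn (fun e f hef => hp' ⟨(e, f), hef⟩) e
  have hrank : Module.finrank ℝ (LinearMap.range (Fintype.linearCombination ℝ b)) ≤
      Module.finrank ℝ (LinearMap.range (Fintype.linearCombination ℝ a)) := by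
    rw [Fintype.range_linearCombination, Fintype.range_linearCombination, hspan]
    exact (Submodule.finrank_mono (Submodule.span_mono (by
      rintro _ ⟨k, rfl⟩; exact ⟨_, rfl⟩))).trans (hp.finrank_span_rigidityRow_le q)
  have hker : LinearMap.ker (Fintype.linearCombination ℝ b) =
      LinearMap.ker (Fintype.linearCombination ℝ a) := by
    refine Submodule.eq_of_le_of_finrank_le hle ?_
    have h1 := (Fintype.linearCombination ℝ a).finrank_range_add_finrank_ker
    have h2 := (Fintype.linearCombination ℝ b).finrank_range_add_finrank_ker
    omega
  -- collect the coefficients of repeated pairs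
  let w : κ → ℝ := ∑ i, ω i • Pi.single (⟨(e i, f i), hef i⟩ : κ) (1 : ℝ)
  have hw : ∀ c : κ → Configuration d n →ₗ[ℝ] ℝ, Fintype.linearCombination ℝ c w =
      ∑ i, ω i • c ⟨(e i, f i), hef i⟩ := by
    intro c
    simp only [w, map_sum, map_smul, Fintype.linearCombination_apply_single, one_smul]
  have h1 : w ∈ LinearMap.ker (Fintype.linearCombination ℝ a) := by
    rw [LinearMap.mem_ker, hw]
    exact hω
  rw [← hker, LinearMap.mem_ker, hw] at h1
  exact h1

end Stress

/-! ### Edge bijections that preserve products of vertex weights -/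

section Products

variable {m : ℕ} {α : Fin m → ℝ}

/-- Derivations give the weights `α` arbitrary logarithmic derivatives `A`, up to a common constant,
subject only to the linear condition that keeps the sum of the weights equal to zero. -/
def LogFree (α : Fin m → ℝ) : Prop :=
  ∀ A : Fin m → ℝ, ∑ i, α i * A i = 0 →
    ∃ (D : Derivation ℚ ℝ ℝ) (κ : ℝ), ∀ i, D (α i) = α i * (A i + κ)

theorem exists_ne_ne (hm : 3 ≤ m) (k l : Fin m) : ∃ o, o ≠ k ∧ o ≠ l := by
  obtain ⟨o, ho⟩ := Finset.exists_mem_notMem_of_card_lt_card (s := {k, l})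
    (t := (Finset.univ : Finset (Fin m)))
    (Finset.card_le_two.trans_lt (by rw [Finset.card_univ, Fintype.card_fin]; omega))
  exact ⟨o, by grind⟩

theorem sum_mul_single_sub_single (N : Fin m → ℝ) (i j : Fin m) (a b : ℝ) :
    ∑ k, N k * (Pi.single (M := fun _ => ℝ) i a k - Pi.single (M := fun _ => ℝ) j b k) =
      N i * a - N j * b := by
  simp [mul_sub, Finset.sum_sub_distrib, Pi.single_apply]

/-- A vector orthogonal to every vector orthogonal to `α` is proportional to `α`. -/
theorem mul_eq_mul_of_orthogonal {N : Fin m → ℝ}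
    (hN : ∀ A : Fin m → ℝ, ∑ i, α i * A i = 0 → ∑ i, N i * A i = 0) (i j : Fin m) :
    N i * α j = N j * α i := by
  have h := hN (fun k => Pi.single (M := fun _ => ℝ) i (α j) k -
    Pi.single (M := fun _ => ℝ) j (α i) k) (by rw [sum_mul_single_sub_single]; ring)
  rw [sum_mul_single_sub_single] at h
  linarith

/-- Distinct weights have an irrational ratio. -/
theorem LogFree.eq_zero_of_mul_eq_mul (h : LogFree α) (hα : ∀ i, α i ≠ 0) (hm : 3 ≤ m)
    {i j : Fin m} (hij : i ≠ j) {a b : ℤ} (hab : a * α i = b * α j) : a = 0 := by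
  by_contra ha
  obtain ⟨k, hki, hkj⟩ := exists_ne_ne hm i j
  obtain ⟨D, κ, hD⟩ := h (fun l => Pi.single (M := fun _ => ℝ) i (α k) l -
    Pi.single (M := fun _ => ℝ) k (α i) l) (by rw [sum_mul_single_sub_single]; ring)
  have h1 := congrArg D hab
  rw [← zsmul_eq_mul, ← zsmul_eq_mul, map_zsmul, map_zsmul, hD, hD, zsmul_eq_mul,
    zsmul_eq_mul] at h1
  simp only [Pi.single_eq_same, Pi.single_eq_of_ne hki.symm, Pi.single_eq_of_ne hkj.symm,
    Pi.single_eq_of_ne hij.symm, sub_zero, zero_add] at h1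
  have h2 : (a : ℝ) * α i * α k = 0 := by linear_combination h1 - κ * hab
  simp [hα, ha] at h2

/-- The weights satisfy no multiplicative relation with integer exponents. -/
theorem LogFree.eq_zero_of_orthogonal (h : LogFree α) (hα : ∀ i, α i ≠ 0) (hm : 3 ≤ m)
    {N : Fin m → ℤ} (hN : ∀ A : Fin m → ℝ, ∑ i, α i * A i = 0 → ∑ i, (N i : ℝ) * A i = 0) :
    N = 0 := by
  funext i
  obtain ⟨j, hj, -⟩ := exists_ne_ne hm i i
  exact h.eq_zero_of_mul_eq_mul hα hm hj (mul_eq_mul_of_orthogonal hN i j)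

/-- The indicator function of the endpoints of the pair `e`, as an integer vector. -/
def endpoints (e : Fin m × Fin m) (i : Fin m) : ℤ :=
  (if i = e.1 then 1 else 0) + if i = e.2 then 1 else 0

theorem sum_endpoints_mul (e : Fin m × Fin m) (A : Fin m → ℝ) :
    ∑ i, (endpoints e i : ℝ) * A i = A e.1 + A e.2 := by
  simp [endpoints, add_mul, Finset.sum_add_distrib]

theorem sum_endpoints (e : Fin m × Fin m) : ∑ i, endpoints e i = 2 := by
  simp [endpoints, Finset.sum_add_distrib]

/-- A function on pairs that satisfies all four-cycle relations is a sum of vertex potentials. -/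
theorem exists_potential (hm : 3 ≤ m) {χ : Fin m → Fin m → ℤ} (hsymm : ∀ k l, χ k l = χ l k)
    (hχ : ∀ k l o r, k ≠ l → o ≠ r → k ≠ o → l ≠ r → k ≠ r → l ≠ o →
      χ k l + χ o r = χ k o + χ l r) :
    ∃ u : Fin m → ℤ, ∀ k l, k ≠ l → u k + u l = 2 * χ k l := by
  let z : Fin m := ⟨0, by omega⟩
  let a : Fin m := ⟨1, by omega⟩
  let b : Fin m := ⟨2, by omega⟩
  have hza : z ≠ a := by simp [z, a]
  have hzb : z ≠ b := by simp [z, b]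
  have hab : a ≠ b := by simp [a, b]
  have h0 : ∀ l, l ≠ z → l ≠ a → χ z a + χ z l - χ a l = χ z a + χ z b - χ a b := by
    intro l hlz hla
    by_cases hlb : l = b
    · rw [hlb]
    · have := hχ z l b a hlz.symm hab.symm hzb hla hza hlb
      rw [hsymm b a, hsymm l a] at this
      linarith
  have h1 : ∀ k l, k ≠ l → k ≠ z → l ≠ z → χ z k + χ z l - χ k l = χ z a + χ z b - χ a b := by
    intro k l hkl hkz hlz
    by_cases hka : k = a
    · rw [hka]; exact h0 l hlz fun h => hkl (hka.trans h.symm)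
    · by_cases hla : l = a
      · rw [hla, ← h0 k hkz hka, hsymm k a]; ring
      · rw [← h0 l hlz hla]
        have := hχ z k a l hkz.symm (Ne.symm hla) hza hkl hlz.symm hka
        linarith
  refine ⟨fun k => if k = z then χ z a + χ z b - χ a b else
    2 * χ z k - (χ z a + χ z b - χ a b), fun k l hkl => ?_⟩
  by_cases hk : k = z
  · have hl : l ≠ z := fun h => hkl (hk.trans h.symm)
    simp only [if_pos hk, if_neg hl]
    rw [hk]
    ring
  · by_cases hl : l = z
    · simp only [if_pos hl, if_neg hk]
      rw [hl, hsymm k z]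
      ring
    · simp only [if_neg hk, if_neg hl]
      have := h1 k l hkl hk hl
      linarith

/-- Integers whose pairwise sums take both values `0` and `2` and no other are, with one exception,
all `0` (and the exception is `2`) or all `1` (and the exception is `-1`). -/
theorem exists_exceptional_index {x : Fin m → ℤ} (hm : 3 ≤ m)
    (hx : ∀ k l, k ≠ l → x k + x l = 0 ∨ x k + x l = 2)
    (h2 : ∃ k l, k ≠ l ∧ x k + x l = 2) (h0 : ∃ k l, k ≠ l ∧ x k + x l = 0) :
    ∃ k, (x k = 2 ∧ ∀ l, l ≠ k → x l = 0) ∨ (x k = -1 ∧ ∀ l, l ≠ k → x l = 1) := by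
  have hrange : ∀ k l, k ≠ l → (x k = 2 ∧ x l = 0) ∨ (x k = 0 ∧ x l = 2) ∨
      (x k = -1 ∧ x l = 1) ∨ (x k = 1 ∧ x l = -1) ∨ (x k = 0 ∧ x l = 0) ∨
        (x k = 1 ∧ x l = 1) := by
    intro k l hkl
    obtain ⟨o, hok, hol⟩ := exists_ne_ne hm k l
    have h1 := hx k l hkl
    have h2 := hx k o hok.symm
    have h3 := hx l o hol.symm
    omega
  by_cases h : ∃ k, x k = 2 ∨ x k = -1
  · obtain ⟨k, hk⟩ := h
    refine ⟨k, ?_⟩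
    rcases hk with hk | hk
    · exact Or.inl ⟨hk, fun l hl => by have := hrange k l hl.symm; omega⟩
    · exact Or.inr ⟨hk, fun l hl => by have := hrange k l hl.symm; omega⟩
  · exfalso
    push Not at h
    obtain ⟨k, l, hkl, h2⟩ := h2
    obtain ⟨o, r, hor, h0⟩ := h0
    have hk := h k
    have hl := h l
    have ho := h o
    have hr := h r
    have h3 := hrange k l hkl
    have h4 := hrange o r hor
    by_cases hko : k = o
    · subst hko
      omega
    · have h5 := hrange k o hko
      omega


/-- Logarithmic differentiation of a correspondence between products of weights: a first-order
change `A` of the weights `α` induces one of the weights `β`. -/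
theorem LogFree.exists_log_change (hfree : LogFree α) {β : Fin m → ℝ}
    (hβ : ∀ k, β k ≠ 0) (hβ0 : ∑ k, β k = 0) {c : ℝ} (hc : c ≠ 0)
    {ψ : Fin m → Fin m → Fin m × Fin m}
    (hprod : ∀ k l, k ≠ l → α (ψ k l).1 * α (ψ k l).2 = c * (β k * β l))
    {A : Fin m → ℝ} (hA : ∑ i, α i * A i = 0) :
    ∃ B : Fin m → ℝ, ∑ k, β k * B k = 0 ∧
      ∀ k l, k ≠ l → A (ψ k l).1 + A (ψ k l).2 = B k + B l := by
  obtain ⟨D, κ, hD⟩ := hfree A hA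
  refine ⟨fun k => D (β k) / β k + (D c / c / 2 - κ), ?_, fun k l hkl => ?_⟩
  · have h1 : ∀ k, β k * (D (β k) / β k + (D c / c / 2 - κ)) =
        D (β k) + β k * (D c / c / 2 - κ) := fun k => by
      rw [mul_add, mul_div_cancel₀ _ (hβ k)]
    simp only [h1, Finset.sum_add_distrib, ← Finset.sum_mul, ← map_sum, hβ0, map_zero, zero_mul,
      add_zero]
  · have h1 := hprod k l hkl
    have h2 := congrArg D h1
    simp only [Derivation.leibniz, smul_eq_mul, hD] at h2
    have h3 : c * (β k * β l) * (A (ψ k l).1 + A (ψ k l).2 + 2 * κ) =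
        c * (β k * D (β l) + β l * D (β k)) + β k * β l * D c := by
      rw [← h2, ← h1]
      ring
    have hk := hβ k
    have hl := hβ l
    field_simp
    linear_combination 2 * h3

theorem LogFree.comp_perm (h : LogFree α) (e : Equiv.Perm (Fin m)) : LogFree (α ∘ e) := by
  intro A hA
  obtain ⟨D, κ, hD⟩ := h (A ∘ e.symm) (by
    rw [← hA, ← Equiv.sum_comp e]
    simp)
  exact ⟨D, κ, fun i => by simp [hD]⟩

/-- The two products of weights over the parts of a partition of four vertices into pairs are
independent, so the complementation of edges does not come from proportional weights. -/
theorem LogFree.false_of_complement {a β : Fin 4 → ℝ} (h : LogFree a) (ha : ∀ i, a i ≠ 0) {c : ℝ}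
    (hβ : ∀ k l, β k * a l = β l * a k) (h1 : a 2 * a 3 = c * (β 0 * β 1))
    (h2 : a 0 * a 1 = c * (β 2 * β 3)) : False := by
  have hsq : (a 0 * a 1 - a 2 * a 3) * (a 0 * a 1 + a 2 * a 3) = 0 := by
    have h5 : β 0 * β 1 * (a 2 * a 3) = β 2 * β 3 * (a 0 * a 1) := by
      linear_combination β 1 * a 3 * hβ 0 2 + β 2 * a 0 * hβ 1 3
    linear_combination (a 0 * a 1) * h2 - (a 2 * a 3) * h1 - c * h5
  obtain ⟨D, κ, hD⟩ := h (fun i => Pi.single (M := fun _ => ℝ) 2 (a 0) i -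
    Pi.single (M := fun _ => ℝ) 0 (a 2) i) (by rw [sum_mul_single_sub_single]; ring)
  have hD0 : D (a 0) = a 0 * (-a 2 + κ) := by simp [hD]
  have hD1 : D (a 1) = a 1 * κ := by simp [hD]
  have hD2 : D (a 2) = a 2 * (a 0 + κ) := by simp [hD]
  have hD3 : D (a 3) = a 3 * κ := by simp [hD]
  have hne : a 2 * a 3 ≠ 0 := mul_ne_zero (ha _) (ha _)
  have hfin : a 0 + a 2 = 0 := by
    refine (mul_eq_zero.1 (?_ : (a 2 * a 3) * (a 0 + a 2) = 0)).resolve_left hne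
    rcases mul_eq_zero.1 hsq with h | h
    · have h3 := congrArg D h
      simp only [map_sub, Derivation.leibniz, smul_eq_mul, hD0, hD1, hD2, hD3, map_zero] at h3
      linear_combination (-1) * h3 + (2 * κ - a 2) * h
    · have h3 := congrArg D h
      simp only [map_add, Derivation.leibniz, smul_eq_mul, hD0, hD1, hD2, hD3, map_zero] at h3
      linear_combination h3 - (2 * κ - a 2) * h
  refine one_ne_zero (h.eq_zero_of_mul_eq_mul ha (by norm_num) (i := 0) (j := 2) (by decide)
    (a := 1) (b := -1) ?_)
  push_cast
  linarith

/-- A bijection between the edges of two complete graphs that turns products of vertex weights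
`β` into products of vertex weights `α`, up to a constant, is induced by a bijection of the
vertices, when the weights `β` sum to zero and the weights `α` are otherwise free. For four
vertices the complementation of edges has to be excluded as well. -/
theorem LogFree.exists_perm (hfree : LogFree α) (hm : 4 ≤ m) {β : Fin m → ℝ}
    (hα : ∀ i, α i ≠ 0) (hβ : ∀ k, β k ≠ 0) (hβ0 : ∑ k, β k = 0) {c : ℝ} (hc : c ≠ 0)
    {ψ : Fin m → Fin m → Fin m × Fin m}
    (hne : ∀ k l, k ≠ l → (ψ k l).1 ≠ (ψ k l).2) (hswap : ∀ k l, k ≠ l → ψ l k = (ψ k l).swap)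
    (hsurj : ∀ i j, i ≠ j → ∃ k l, k ≠ l ∧ ψ k l = (i, j))
    (hprod : ∀ k l, k ≠ l → α (ψ k l).1 * α (ψ k l).2 = c * (β k * β l)) :
    ∃ s : Equiv.Perm (Fin m), ∀ k l, k ≠ l → ψ k l = (s k, s l) ∨ ψ k l = (s l, s k) := by
  have hm3 : 3 ≤ m := by omega
  -- the four-cycle relations
  have hcyc : ∀ i k l o r, k ≠ l → o ≠ r → k ≠ o → l ≠ r → k ≠ r → l ≠ o →
      endpoints (ψ k l) i + endpoints (ψ o r) i = endpoints (ψ k o) i + endpoints (ψ l r) i := by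
    intro i k l o r hkl hor hko hlr _ _
    have h0 : (fun i => endpoints (ψ k l) i + endpoints (ψ o r) i - endpoints (ψ k o) i -
        endpoints (ψ l r) i) = 0 := by
      refine hfree.eq_zero_of_orthogonal hα hm3 fun A hA => ?_
      obtain ⟨B, -, hB⟩ := hfree.exists_log_change hβ hβ0 hc hprod hA
      push_cast
      simp only [sub_mul, add_mul, Finset.sum_sub_distrib, Finset.sum_add_distrib,
        sum_endpoints_mul, hB _ _ hkl, hB _ _ hor, hB _ _ hko, hB _ _ hlr]
      ring
    have := congrFun h0 i
    simp only [Pi.zero_apply] at this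
    linarith
  have hsymm : ∀ i k l, endpoints (ψ k l) i = endpoints (ψ l k) i := by
    intro i k l
    by_cases hkl : k = l
    · rw [hkl]
    · rw [hswap k l hkl, endpoints, endpoints, add_comm]
      rfl
  choose u hu using fun i => exists_potential hm3 (hsymm i) (hcyc i)
  -- the values of the potentials at a fixed `i`
  have hval : ∀ i k l, k ≠ l → endpoints (ψ k l) i = 0 ∨ endpoints (ψ k l) i = 1 := by
    intro i k l hkl
    have := hne k l hkl
    unfold endpoints
    split_ifs with h1 h2
    · exact absurd (h1.symm.trans h2) this
    all_goals simp
  have hexc : ∀ i, ∃ k, (u i k = 2 ∧ ∀ l, l ≠ k → u i l = 0) ∨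
      (u i k = -1 ∧ ∀ l, l ≠ k → u i l = 1) := by
    intro i
    obtain ⟨j, hji, -⟩ := exists_ne_ne hm3 i i
    obtain ⟨o, hoj, hoi⟩ := exists_ne_ne hm3 j i
    refine exists_exceptional_index hm3 (fun k l hkl => ?_) ?_ ?_
    · have := hval i k l hkl
      have := hu i k l hkl
      omega
    · obtain ⟨k, l, hkl, h⟩ := hsurj i j hji.symm
      refine ⟨k, l, hkl, ?_⟩
      rw [hu i k l hkl, h]
      simp [endpoints, hji.symm]
    · obtain ⟨k, l, hkl, h⟩ := hsurj o j hoj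
      refine ⟨k, l, hkl, ?_⟩
      rw [hu i k l hkl, h]
      simp [endpoints, hji.symm, hoi.symm]
  choose s hs using hexc
  -- the weighted sum of the potentials is proportional to `α`
  let w : Fin m → ℝ := fun i => ∑ k, β k * u i k
  have hw : ∀ i j, w i * α j = w j * α i := by
    refine mul_eq_mul_of_orthogonal fun A hA => ?_
    obtain ⟨B, hB0, hB⟩ := hfree.exists_log_change hβ hβ0 hc hprod hA
    have hpair : ∀ k l, k ≠ l → ∑ i, (u i k : ℝ) * A i + ∑ i, (u i l : ℝ) * A i =
        2 * (B k + B l) := by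
      intro k l hkl
      rw [← hB k l hkl, ← sum_endpoints_mul, Finset.mul_sum, ← Finset.sum_add_distrib]
      refine Finset.sum_congr rfl fun i _ => ?_
      have : (u i k : ℝ) + u i l = 2 * endpoints (ψ k l) i := by exact_mod_cast hu i k l hkl
      linear_combination A i * this
    have hone : ∀ k, ∑ i, (u i k : ℝ) * A i = 2 * B k := by
      intro k
      obtain ⟨l, hl, -⟩ := exists_ne_ne hm3 k k
      obtain ⟨o, hok, hol⟩ := exists_ne_ne hm3 k l
      have h1 := hpair k l hl.symm
      have h2 := hpair k o hok.symm
      have h3 := hpair l o hol.symm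
      linarith
    calc ∑ i, w i * A i = ∑ k, β k * ∑ i, (u i k : ℝ) * A i := by
          simp only [w, Finset.sum_mul, Finset.mul_sum]
          rw [Finset.sum_comm]
          simp only [mul_assoc]
      _ = 2 * ∑ k, β k * B k := by
          simp only [hone, Finset.mul_sum]
          exact Finset.sum_congr rfl fun k _ => by ring
      _ = 0 := by rw [hB0, mul_zero]
  have hws : ∀ i, (u i (s i) = 2 ∧ w i = 2 * β (s i)) ∨ (u i (s i) = -1 ∧ w i = -2 * β (s i)) := by
    intro i
    rcases hs i with ⟨h1, h2⟩ | ⟨h1, h2⟩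
    · refine Or.inl ⟨h1, ?_⟩
      simp only [w]
      rw [Finset.sum_eq_single (s i) (fun k _ hk => by simp [h2 k hk]) (by simp), h1]
      push_cast
      ring
    · refine Or.inr ⟨h1, ?_⟩
      have h3 : ∀ k, β k * (u i k : ℝ) = β k - 2 * if k = s i then β k else 0 := by
        intro k
        by_cases hk : k = s i
        · rw [if_pos hk, hk, h1]
          push_cast
          ring
        · rw [if_neg hk, h2 k hk]
          push_cast
          ring
      simp only [w, h3, Finset.sum_sub_distrib, hβ0, ← Finset.mul_sum]
      simp
  have hinj : Function.Injective s := by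
    intro i j hij
    by_contra hne'
    have h1 := hw j i
    have h2 := hβ (s j)
    rcases hws i with ⟨-, h3⟩ | ⟨-, h3⟩ <;> rcases hws j with ⟨-, h4⟩ | ⟨-, h4⟩ <;>
      rw [h3, h4, hij] at h1
    · have h5 : ((1 : ℤ) : ℝ) * α i = ((1 : ℤ) : ℝ) * α j := by
        push_cast
        exact mul_left_cancel₀ h2 (by linarith)
      exact one_ne_zero (hfree.eq_zero_of_mul_eq_mul hα hm3 hne' h5)
    · have h5 : ((1 : ℤ) : ℝ) * α i = ((-1 : ℤ) : ℝ) * α j := by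
        push_cast
        exact mul_left_cancel₀ h2 (by linarith)
      exact one_ne_zero (hfree.eq_zero_of_mul_eq_mul hα hm3 hne' h5)
    · have h5 : ((1 : ℤ) : ℝ) * α i = ((-1 : ℤ) : ℝ) * α j := by
        push_cast
        exact mul_left_cancel₀ h2 (by linarith)
      exact one_ne_zero (hfree.eq_zero_of_mul_eq_mul hα hm3 hne' h5)
    · have h5 : ((1 : ℤ) : ℝ) * α i = ((1 : ℤ) : ℝ) * α j := by
        push_cast
        exact mul_left_cancel₀ h2 (by linarith)
      exact one_ne_zero (hfree.eq_zero_of_mul_eq_mul hα hm3 hne' h5)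
  let e : Equiv.Perm (Fin m) := Equiv.ofBijective s (Finite.injective_iff_bijective.1 hinj)
  have hes : ∀ k, s (e.symm k) = k := fun k => e.apply_symm_apply k
  have hse : ∀ k, e.symm (s k) = k := fun k => e.symm_apply_apply k
  have hrow : ∀ k, ∑ i, u i k = 2 := by
    have hpair : ∀ k l, k ≠ l → ∑ i, u i k + ∑ i, u i l = 4 := by
      intro k l hkl
      rw [← Finset.sum_add_distrib, Finset.sum_congr rfl fun i _ => hu i k l hkl,
        ← Finset.mul_sum, sum_endpoints]
      norm_num
    intro k
    obtain ⟨l, hl, -⟩ := exists_ne_ne hm3 k k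
    obtain ⟨o, hok, hol⟩ := exists_ne_ne hm3 k l
    have h1 := hpair k l hl.symm
    have h2 := hpair k o hok.symm
    have h3 := hpair l o hol.symm
    omega
  by_cases hI : ∃ i, u i (s i) = 2
  · -- all columns are of the first type, and `s` is the required bijection
    obtain ⟨i₀, hi₀⟩ := hI
    have h1 : ∑ i ∈ Finset.univ.erase i₀, u i (s i₀) = 0 := by
      have h2 := Finset.add_sum_erase Finset.univ (fun i => u i (s i₀)) (Finset.mem_univ i₀)
      rw [hrow] at h2
      simp only [hi₀] at h2
      linarith
    have hnonneg : ∀ i ∈ Finset.univ.erase i₀, 0 ≤ u i (s i₀) := by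
      intro i hi
      have h2 : s i₀ ≠ s i := fun h => (Finset.ne_of_mem_erase hi) (hinj h).symm
      rcases hs i with ⟨-, h3⟩ | ⟨-, h3⟩ <;> rw [h3 _ h2]
      exact zero_le_one
    rw [Finset.sum_eq_zero_iff_of_nonneg hnonneg] at h1
    have hall : ∀ i, u i (s i) = 2 ∧ ∀ l, l ≠ s i → u i l = 0 := by
      intro i
      by_cases hii : i = i₀
      · rw [hii]
        exact (hs i₀).resolve_right fun h => by rw [h.1] at hi₀; norm_num at hi₀
      · refine (hs i).resolve_right fun h => ?_
        have h2 := h1 i (Finset.mem_erase.2 ⟨hii, Finset.mem_univ i⟩)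
        rw [h.2 _ fun h => hii (hinj h).symm] at h2
        norm_num at h2
    have hmem : ∀ k l, k ≠ l → ∀ i, endpoints (ψ k l) i = 1 → s i = k ∨ s i = l := by
      intro k l hkl i hi
      by_contra hcon
      push Not at hcon
      have h2 := hu i k l hkl
      rw [(hall i).2 k hcon.1.symm, (hall i).2 l hcon.2.symm, hi] at h2
      norm_num at h2
    refine ⟨e.symm, fun k l hkl => ?_⟩
    have hn := hne k l hkl
    have h2 := hmem k l hkl (ψ k l).1 (by simp [endpoints, hn])
    have h3 := hmem k l hkl (ψ k l).2 (by simp [endpoints, hn.symm])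
    have h4 : s (ψ k l).1 ≠ s (ψ k l).2 := fun h => hn (hinj h)
    have he : ∀ {i j}, s i = j → i = e.symm j := fun h => by rw [← h, hse]
    rcases h2 with h2 | h2 <;> rcases h3 with h3 | h3
    · exact absurd (h2.trans h3.symm) h4
    · exact Or.inl (Prod.ext (he h2) (he h3))
    · exact Or.inr (Prod.ext (he h2) (he h3))
    · exact absurd (h2.trans h3.symm) h4
  · -- all columns are of the second type: `m = 4` and `ψ` complements edges
    exfalso
    push Not at hI
    have hall : ∀ i, u i (s i) = -1 ∧ ∀ l, l ≠ s i → u i l = 1 :=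
      fun i => (hs i).resolve_left fun h => hI i h.1
    let i₀ : Fin m := ⟨0, by omega⟩
    have hm4 : m = 4 := by
      have h2 := Finset.add_sum_erase Finset.univ (fun i => u i (s i₀)) (Finset.mem_univ i₀)
      rw [hrow, Finset.sum_congr rfl (g := fun _ => (1 : ℤ)) (fun i hi =>
        (hall i).2 _ fun h => (Finset.ne_of_mem_erase hi) (hinj h).symm)] at h2
      simp only [(hall i₀).1, Finset.sum_const, Finset.card_erase_of_mem (Finset.mem_univ i₀),
        Finset.card_univ, Fintype.card_fin] at h2
      simp at h2
      omega
    subst hm4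
    have hmem : ∀ k l, k ≠ l → ∀ i, endpoints (ψ k l) i = 1 → s i ≠ k ∧ s i ≠ l := by
      intro k l hkl i hi
      have h2 := hu i k l hkl
      rw [hi] at h2
      constructor
      · intro h
        rw [← h, (hall i).1, (hall i).2 l fun h' => hkl (h.symm.trans h'.symm)] at h2
        norm_num at h2
      · intro h
        rw [← h, (hall i).1, (hall i).2 k fun h' => hkl (h'.trans h)] at h2
        norm_num at h2
    have hwa : ∀ k l, β k * (α ∘ e.symm) l = β l * (α ∘ e.symm) k := by
      intro k l
      have h2 := hw (e.symm k) (e.symm l)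
      have h3 : ∀ k, w (e.symm k) = -2 * β k := fun k => by
        have := (hws (e.symm k)).resolve_left fun h => hI _ h.1
        rw [this.2, hes]
      rw [h3, h3] at h2
      simp only [Function.comp_apply]
      linarith
    have hcompl : ∀ k l o r : Fin 4, k ≠ l → (∀ x, x ≠ k → x ≠ l → x = o ∨ x = r) →
        (α ∘ e.symm) o * (α ∘ e.symm) r = c * (β k * β l) := by
      intro k l o r hkl hor
      have hn := hne k l hkl
      have h2 := hmem k l hkl (ψ k l).1 (by simp [endpoints, hn])
      have h3 := hmem k l hkl (ψ k l).2 (by simp [endpoints, hn.symm])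
      have h4 : s (ψ k l).1 ≠ s (ψ k l).2 := fun h => hn (hinj h)
      have he : ∀ {i j}, s i = j → e.symm j = i := fun h => by rw [← h, hse]
      rw [← hprod k l hkl, Function.comp_apply, Function.comp_apply]
      rcases hor _ h2.1 h2.2 with h5 | h5 <;> rcases hor _ h3.1 h3.2 with h6 | h6
      · exact absurd (h5.trans h6.symm) h4
      · rw [he h5, he h6]
      · rw [he h5, he h6, mul_comm]
      · exact absurd (h5.trans h6.symm) h4
    exact (hfree.comp_perm e.symm).false_of_complement (fun k => hα _) hwa
      (hcompl 0 1 2 3 (by decide) (by decide)) (hcompl 2 3 0 1 (by decide) (by decide))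

end Products

/-! ### Complete graphs on `d + 2` vertices -/

section Clique

variable {d n : ℕ} {p q : Configuration d n} {π : Equiv.Perm (Fin n)}

/-- The coefficients of an affine dependency of `d + 2` points of a generic configuration are free
up to scale: any first-order change of them that keeps their sum zero is compensated by moving one
of the points, and derivations realize all motions. -/
theorem IsGeneric.logFree (hp : IsGeneric p) {m : ℕ} {r : Fin m → Fin n}
    (hr : Function.Injective r) {α : Fin m → ℝ} (hα : ∀ k, α k ≠ 0) (hsum : ∑ k, α k = 0)
    (hdep : ∑ k, α k • p (r k) = 0)
    (huniq : ∀ γ : Fin m → ℝ, ∑ k, γ k = 0 → ∑ k, γ k • p (r k) = 0 → ∃ κ : ℝ, γ = κ • α) :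
    LogFree α := by
  intro A hA
  rcases Nat.eq_zero_or_pos m with rfl | hm
  · exact ⟨0, 0, fun i => i.elim0⟩
  let z : Fin m := ⟨0, hm⟩
  obtain ⟨D, hD⟩ := hp.exists_derivation
    (Pi.single (r z) (-(α z)⁻¹ • ∑ k, (α k * A k) • p (r k)))
  have hDr : ∀ k, derivVec D (p (r k)) =
      if k = z then -(α z)⁻¹ • ∑ k, (α k * A k) • p (r k) else 0 := by
    intro k
    rw [show derivVec D (p (r k)) = _ from congrFun hD (r k), Pi.single_apply]
    simp [hr.eq_iff]
  have h1 : ∑ k, (D (α k) - α k * A k) = 0 := by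
    rw [Finset.sum_sub_distrib, hA, ← map_sum, hsum, map_zero, sub_zero]
  have h2 : ∑ k, (D (α k) - α k * A k) • p (r k) = 0 := by
    have h3 := congrArg (derivVec D) hdep
    simp only [map_sum, derivVec_smul, hDr, map_zero, Finset.sum_add_distrib] at h3
    have h4 : ∀ v : EuclideanSpace ℝ (Fin d), ∑ k, α k • (if k = z then v else 0) = α z • v := by
      intro v
      simp
    rw [h4, smul_smul, mul_neg, mul_inv_cancel₀ (hα z), neg_one_smul] at h3
    simp only [sub_smul, Finset.sum_sub_distrib]
    rw [sub_eq_add_neg, h3]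
  obtain ⟨κ, hκ⟩ := huniq _ h1 h2
  refine ⟨D, κ, fun i => ?_⟩
  have h3 := congrFun hκ i
  simp only [Pi.smul_apply, smul_eq_mul] at h3
  linear_combination h3

/-- The products of the coefficients of an affine dependency form a stress of the complete graph. -/
theorem sum_mul_smul_rigidityRow_eq_zero {ι : Type*} [Fintype ι] (r : ι → Fin n) {α : ι → ℝ}
    (hsum : ∑ k, α k = 0) (hdep : ∑ k, α k • p (r k) = 0) :
    ∑ e : ι × ι, (α e.1 * α e.2) • rigidityRow p (r e.1, r e.2) = 0 := by
  refine LinearMap.ext fun p' => ?_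
  have h1 : ∀ f : ι → EuclideanSpace ℝ (Fin d),
      ∑ i, ∑ j, α i * α j * inner ℝ (p (r i)) (f j) = 0 := by
    intro f
    have : inner ℝ (∑ k, α k • p (r k)) (∑ j, α j • f j) = 0 := by rw [hdep, inner_zero_left]
    rw [← this, sum_inner]
    refine Finset.sum_congr rfl fun i _ => ?_
    rw [inner_sum]
    refine Finset.sum_congr rfl fun j _ => ?_
    rw [real_inner_smul_left, real_inner_smul_right]
    ring
  have h2 : ∀ f : ι → ℝ, ∑ i, ∑ j, α i * α j * f i = 0 := by
    intro f
    have : ∀ i, ∑ j, α i * α j * f i = 0 := fun i => by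
      rw [← Finset.sum_mul, ← Finset.mul_sum, hsum, mul_zero, zero_mul]
    simp [this]
  have h3 : ∀ f : ι → ι → ℝ, ∑ i, ∑ j, α i * α j * f i j = ∑ i, ∑ j, α i * α j * f j i := by
    intro f
    rw [Finset.sum_comm]
    exact Finset.sum_congr rfl fun i _ => Finset.sum_congr rfl fun j _ => by ring
  simp only [LinearMap.sum_apply, LinearMap.smul_apply, rigidityRow_apply, LinearMap.zero_apply,
    Fintype.sum_prod_type, inner_sub_left, inner_sub_right, smul_eq_mul, mul_sub,
    Finset.sum_sub_distrib]
  have h4 := h1 fun j => p' (r j)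
  have h5 := h3 fun i j => inner ℝ (p (r j)) (p' (r i))
  have h6 := h2 fun i => inner ℝ (p (r i)) (p' (r i))
  have h7 := h3 fun i j => inner ℝ (p (r j)) (p' (r j))
  rw [h4, h5, h4, h6, h7, h6]
  simp

/-- A symmetric stress is in equilibrium at each vertex. -/
theorem sum_smul_sub_eq_zero_of_stress {Ω : Fin n → Fin n → ℝ} (hsymm : ∀ k l, Ω k l = Ω l k)
    (h : ∑ e : Fin n × Fin n, Ω e.1 e.2 • rigidityRow q e = 0) (w : Fin n) :
    ∑ l, Ω w l • (q w - q l) = 0 := by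
  set v := ∑ l, Ω w l • (q w - q l) with hv
  have h1 := LinearMap.congr_fun h (Pi.single w v)
  simp only [LinearMap.sum_apply, LinearMap.smul_apply, rigidityRow_apply, LinearMap.zero_apply,
    Fintype.sum_prod_type, inner_sub_right, smul_eq_mul, mul_sub, Finset.sum_sub_distrib] at h1
  have hvv : ∀ z, inner ℝ v z = ∑ l, Ω w l * inner ℝ (q w - q l) z := by
    intro z
    simp only [hv, sum_inner, real_inner_smul_left]
  have h2 : ∑ k, ∑ l, Ω k l * inner ℝ (q k - q l) (Pi.single (M := fun _ => _) w v k) =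
      inner ℝ v v := by
    rw [Finset.sum_eq_single w (fun k _ hk => by simp [hk]) (by simp)]
    simp only [Pi.single_eq_same, hvv v]
  have h3 : ∑ k, ∑ l, Ω k l * inner ℝ (q k - q l) (Pi.single (M := fun _ => _) w v l) =
      -inner ℝ v v := by
    rw [Finset.sum_comm, Finset.sum_eq_single w (fun k _ hk => by simp [hk]) (by simp)]
    rw [hvv v, ← Finset.sum_neg_distrib]
    refine Finset.sum_congr rfl fun l _ => ?_
    rw [hsymm l w, ← neg_sub (q w) (q l), inner_neg_left, mul_neg, Pi.single_eq_same]
  rw [h2, h3] at h1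
  have h4 : inner ℝ v v = 0 := by linarith
  exact inner_self_eq_zero.1 h4

/-- The affine dependency at the vertex `w` that expresses the equilibrium of a stress. -/
theorem equilibrium_dependency {ι : Type*} [Fintype ι] [DecidableEq ι]
    {x : ι → EuclideanSpace ℝ (Fin d)} {ω : ι → ℝ} {w : ι} (h : ∑ l, ω l • (x w - x l) = 0) :
    ∑ l, ((if l = w then ∑ k, ω k else 0) - ω l) = 0 ∧
      ∑ l, ((if l = w then ∑ k, ω k else 0) - ω l) • x l = 0 := by
  constructor
  · simp [Finset.sum_sub_distrib]
  · rw [← h]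
    simp [sub_smul, smul_sub, Finset.sum_sub_distrib, Finset.sum_smul]

/-- A graph with `(d + 2) (d + 1)` darts that carries a nowhere vanishing equilibrium stress in a
configuration in general position is a complete graph on `d + 2` vertices, because each of its
vertices has degree at least `d + 1`. -/
theorem exists_eq_offDiag_of_stress (hq : DistGeneric q) (hn : d + 1 ≤ n)
    {E : Finset (Fin n × Fin n)} (hE : E.card = (d + 2) * (d + 1))
    (hswap : ∀ e ∈ E, e.swap ∈ E) (hne : ∀ e ∈ E, e.1 ≠ e.2) {Ω : Fin n → Fin n → ℝ}
    (hΩ : ∀ k l, Ω k l ≠ 0 ↔ (k, l) ∈ E) (heq : ∀ w, ∑ l, Ω w l • (q w - q l) = 0) :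
    ∃ V : Finset (Fin n), V.card = d + 2 ∧ E = V.offDiag := by
  let V := E.image Prod.fst
  have hdeg : ∀ w ∈ V, d + 1 ≤ (E.filter fun e => e.1 = w).card := by
    intro w hw
    by_contra! hlt
    obtain ⟨⟨w', l⟩, he, rfl⟩ := Finset.mem_image.1 hw
    obtain ⟨h1, h2⟩ := equilibrium_dependency (heq w')
    have h3 := hq.eq_zero_of_affine_dependency hn
      (S := insert w' ((E.filter fun e => e.1 = w').image Prod.snd)) ?_ ?_ h1 h2
    · have h4 := congrFun h3 l
      have h5 := hne _ he
      simp only [if_neg h5.symm, zero_sub, Pi.zero_apply, neg_eq_zero] at h4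
      exact (hΩ _ _).2 he h4
    · exact (Finset.card_insert_le _ _).trans (by
        have := Finset.card_image_le (s := E.filter fun e => e.1 = w') (f := Prod.snd)
        simp only at hlt
        omega)
    · intro l hl
      rw [Finset.mem_insert, not_or] at hl
      rw [if_neg hl.1, zero_sub, neg_eq_zero]
      by_contra h4
      exact hl.2 (Finset.mem_image.2 ⟨(w', l), Finset.mem_filter.2 ⟨(hΩ _ _).1 h4, rfl⟩, rfl⟩)
  have hle : V.card ≤ d + 2 := by
    have h1 := Finset.card_eq_sum_card_image Prod.fst E
    have h2 := Finset.card_nsmul_le_sum V _ _ hdeg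
    rw [← h1, hE, smul_eq_mul] at h2
    exact Nat.le_of_mul_le_mul_right h2 (Nat.succ_pos d)
  have hsub : E ⊆ V.offDiag := fun e he => Finset.mem_offDiag.2
    ⟨Finset.mem_image_of_mem _ he, Finset.mem_image.2 ⟨_, hswap e he, rfl⟩, hne e he⟩
  have hcard := Finset.card_le_card hsub
  rw [Finset.offDiag_card, hE, ← Nat.mul_sub_one] at hcard
  have hge : d + 2 ≤ V.card := by
    by_contra! hlt
    have h1 : V.card * (V.card - 1) ≤ (d + 1) * d := Nat.mul_le_mul (by omega) (by omega)
    nlinarith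
  refine ⟨V, by omega, Finset.eq_of_subset_of_card_le hsub ?_⟩
  rw [Finset.offDiag_card, hE, show V.card = d + 2 by omega, ← Nat.mul_sub_one]
  rfl

/-- Stresses of the complete graph on `d + 2` points in general position are multiples of the
products of the coefficients of the affine dependency of the points. -/
theorem exists_stress_eq_mul {m : ℕ} (hm : 2 ≤ m) {x : Fin m → EuclideanSpace ℝ (Fin d)}
    {β : Fin m → ℝ} (hβ : ∀ k, β k ≠ 0)
    (huniq : ∀ γ : Fin m → ℝ, ∑ k, γ k = 0 → ∑ k, γ k • x k = 0 → ∃ κ : ℝ, γ = κ • β)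
    {Ω : Fin m → Fin m → ℝ} (hsymm : ∀ k l, Ω k l = Ω l k)
    (heq : ∀ w, ∑ l, Ω w l • (x w - x l) = 0) :
    ∃ c : ℝ, ∀ k l, k ≠ l → Ω k l = c * (β k * β l) := by
  have h1 : ∀ k, ∃ κ : ℝ, ∀ l, l ≠ k → Ω k l = κ * β l := by
    intro k
    obtain ⟨h1, h2⟩ := equilibrium_dependency (heq k)
    obtain ⟨κ, hκ⟩ := huniq _ h1 h2
    refine ⟨-κ, fun l hl => ?_⟩
    have h3 := congrFun hκ l
    simp only [if_neg hl, zero_sub, Pi.smul_apply, smul_eq_mul] at h3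
    linarith
  choose κ hκ using h1
  let z : Fin m := ⟨0, by omega⟩
  refine ⟨κ z / β z, fun k l hkl => ?_⟩
  have h2 : κ k = κ z / β z * β k := by
    by_cases hk : k = z
    · rw [hk, div_mul_cancel₀ _ (hβ z)]
    · have h3 := hκ k z (Ne.symm hk)
      rw [hsymm, hκ z k hk] at h3
      have := hβ z
      field_simp
      linarith
  rw [hκ k l hkl.symm, h2]
  ring


theorem IsGeneric.injective (hp : IsGeneric p) (hd : 0 < d) : Function.Injective p := by
  intro i j hij
  have h1 : ((i, ⟨0, hd⟩) : Fin n × Fin d) = (j, ⟨0, hd⟩) :=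
    AlgebraicIndependent.injective hp (congrArg (fun v => v ⟨0, hd⟩) hij)
  exact congrArg Prod.fst h1

/-- The matched edges of a complete graph on `d + 2` vertices have their partners in a complete
graph on `d + 2` vertices, and in a way that is induced by a bijection of the vertices. -/
theorem MatchedTrilateration.exists_clique (h : MatchedTrilateration p q π) (hp : IsGeneric p)
    (hd : 2 ≤ d) (hn : d + 2 ≤ n) {r : Fin (d + 2) → Fin n} (hr : Function.Injective r)
    (hm : ∀ i j, i ≠ j → IsMatched p q (r i) (r j)) :
    ∃ t : Fin (d + 2) → Fin n, Function.Injective t ∧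
      ∀ i j, sqDist p (r i, r j) = sqDist q (t i, t j) := by
  have hq := h.distGeneric hp hn
  obtain ⟨g, hg, hgs⟩ : ∃ g : Fin (d + 2) × Fin (d + 2) → Fin n × Fin n,
      (∀ e, sqDist p (r e.1, r e.2) = sqDist q (g e)) ∧ ∀ e, e.1 ≠ e.2 → g e.swap = (g e).swap := by
    have h1 : ∀ i j, ∃ f, i ≠ j → sqDist p (r i, r j) = sqDist q f := by
      intro i j
      by_cases hij : i = j
      · exact ⟨(r i, r i), fun h => absurd hij h⟩
      · obtain ⟨f, hf⟩ := (hm i j hij).2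
        exact ⟨f, fun _ => hf⟩
    choose F hF using h1
    refine ⟨fun e => if e.1 < e.2 then F e.1 e.2 else if e.2 < e.1 then (F e.2 e.1).swap
      else (r e.1, r e.1), fun e => ?_, fun e he => ?_⟩
    · rcases lt_trichotomy e.1 e.2 with hlt | heq | hlt
      · simp only [if_pos hlt]
        exact hF _ _ hlt.ne
      · simp [heq, sqDist]
      · simp only [if_neg hlt.not_gt, if_pos hlt]
        rw [sqDist_swap, ← hF _ _ hlt.ne]
        exact sqDist_swap p (r e.2, r e.1)
    · rcases lt_or_gt_of_ne he with hlt | hlt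
      · simp [hlt, hlt.not_gt]
      · simp [hlt, hlt.not_gt]
  have hpinj := hp.injective (by omega : 0 < d)
  have hgne : ∀ e : Fin (d + 2) × Fin (d + 2), e.1 ≠ e.2 → (g e).1 ≠ (g e).2 := by
    intro e he h1
    have h2 := hg e
    rw [show sqDist q (g e) = 0 by simp [sqDist, h1]] at h2
    have h3 : dist (p (r e.1)) (p (r e.2)) = 0 := pow_eq_zero_iff two_ne_zero |>.1 h2
    exact he (hr (hpinj (dist_eq_zero.1 h3)))
  have hginj : ∀ e e' : Fin (d + 2) × Fin (d + 2), e.1 ≠ e.2 → e'.1 ≠ e'.2 → g e = g e' →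
      e = e' := by
    rintro ⟨i, j⟩ ⟨k, l⟩ he he' h1
    have h2 : sqDist p (r i, r j) = sqDist p (r k, r l) := by
      rw [hg (i, j), hg (k, l), h1]
    rcases hp.distGeneric.eq_of_sqDist_eq (by omega) (hr.ne he) (hr.ne he') h2 with
      ⟨h3, h4⟩ | ⟨h3, h4⟩
    · exact Prod.ext (hr h3) (hr h4)
    · -- otherwise an edge of `q` would be equal to its reversal
      have h5 : (k, l) = Prod.swap (i, j) := Prod.ext (hr h4.symm) (hr h3.symm)
      rw [h5, hgs _ he] at h1
      exact absurd (congrArg Prod.fst h1) (hgne _ he)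
  obtain ⟨α, hα, hα0, hαp, hαu⟩ := hp.distGeneric.exists_affine_dependency (by omega) hr
  -- the stress of the complete graph at `p`, transported to `q`
  let Ω : Fin n → Fin n → ℝ := fun k l =>
    ∑ e ∈ Finset.univ.offDiag.filter (fun e => g e = (k, l)), α e.1 * α e.2
  let E := (Finset.univ : Finset (Fin (d + 2))).offDiag.image g
  have hmem : ∀ e : Fin (d + 2) × Fin (d + 2), e ∈ (Finset.univ : Finset (Fin (d + 2))).offDiag ↔
      e.1 ≠ e.2 := by simp [Finset.mem_offDiag]
  have hE : E.card = (d + 2) * (d + 1) := by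
    rw [Finset.card_image_of_injOn, Finset.offDiag_card, Finset.card_univ, Fintype.card_fin,
      ← Nat.mul_sub_one]
    · rfl
    · intro e he e' he' h1
      exact hginj e e' ((hmem e).1 he) ((hmem e').1 he') h1
  have hΩval : ∀ e, e.1 ≠ e.2 → Ω (g e).1 (g e).2 = α e.1 * α e.2 := by
    intro e he
    simp only [Ω]
    rw [Finset.sum_eq_single e]
    · intro e' he' hne
      rw [Finset.mem_filter, hmem] at he'
      exact absurd (hginj _ _ he'.1 he he'.2) hne
    · intro h1
      rw [Finset.mem_filter] at h1
      exact absurd ⟨(hmem e).2 he, rfl⟩ h1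
  have hΩ0 : ∀ k l, (k, l) ∉ E → Ω k l = 0 := by
    intro k l hkl
    refine Finset.sum_eq_zero fun e he => ?_
    rw [Finset.mem_filter] at he
    exact absurd (Finset.mem_image.2 ⟨e, he⟩) hkl
  have hEsymm : ∀ e ∈ E, e.swap ∈ E := by
    intro f hf
    obtain ⟨e, he, rfl⟩ := Finset.mem_image.1 hf
    rw [hmem] at he
    rw [← hgs e he]
    exact Finset.mem_image_of_mem _ ((hmem _).2 (Ne.symm he))
  have hΩiff : ∀ k l, Ω k l ≠ 0 ↔ (k, l) ∈ E := by
    intro k l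
    refine ⟨fun h1 => by_contra fun h2 => h1 (hΩ0 k l h2), fun h1 => ?_⟩
    obtain ⟨e, he, h2⟩ := Finset.mem_image.1 h1
    have h3 := hΩval e ((hmem e).1 he)
    rw [h2] at h3
    rw [h3]
    exact mul_ne_zero (hα _) (hα _)
  have hΩsymm : ∀ k l, Ω k l = Ω l k := by
    intro k l
    by_cases h1 : (k, l) ∈ E
    · obtain ⟨e, he, h2⟩ := Finset.mem_image.1 h1
      have he' := (hmem e).1 he
      have h3 := hΩval e he'
      have h4 := hΩval e.swap (Ne.symm he')
      rw [h2] at h3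
      rw [hgs e he', h2] at h4
      rw [h3, show Ω l k = _ from h4, mul_comm]
      rfl
    · rw [hΩ0 k l h1, hΩ0 l k fun h2 => h1 (hEsymm _ h2)]
  have hstress : ∑ e : Fin n × Fin n, Ω e.1 e.2 • rigidityRow q e = 0 := by
    have h1 := h.sum_smul_rigidityRow_eq_zero hp hn hg
      (sum_mul_smul_rigidityRow_eq_zero r hα0 hαp)
    have h2 : ∑ e ∈ (Finset.univ : Finset (Fin (d + 2))).offDiag,
        (α e.1 * α e.2) • rigidityRow q (g e) = 0 := by
      rw [← h1]
      refine Finset.sum_subset (Finset.subset_univ _) fun e _ he => ?_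
      rw [hmem, not_not] at he
      have h3 : dist (q (g e).1) (q (g e).2) = 0 := by
        have h4 := hg e
        rw [he] at h4
        simpa [sqDist] using h4.symm
      have h4 : rigidityRow q (g e) = 0 := LinearMap.ext fun x' => by
        rw [rigidityRow_apply, dist_eq_zero.1 h3]
        simp
      rw [h4, smul_zero]
    rw [← h2, ← Finset.sum_fiberwise (Finset.univ : Finset (Fin (d + 2))).offDiag g]
    refine Finset.sum_congr rfl fun f _ => ?_
    rw [Finset.sum_smul]
    exact Finset.sum_congr rfl fun e he => by rw [(Finset.mem_filter.1 he).2]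
  have heq := sum_smul_sub_eq_zero_of_stress hΩsymm hstress
  obtain ⟨V, hV, hEV⟩ := exists_eq_offDiag_of_stress hq (by omega) hE hEsymm (by
    intro f hf
    obtain ⟨e, he, rfl⟩ := Finset.mem_image.1 hf
    exact hgne e ((hmem e).1 he)) hΩiff heq
  let u := V.equivFinOfCardEq hV
  let t : Fin (d + 2) → Fin n := fun k => u.symm k
  have ht : Function.Injective t := Subtype.val_injective.comp u.symm.injective
  have htV : ∀ k, t k ∈ V := fun k => (u.symm k).2
  have htsurj : ∀ v ∈ V, ∃ k, t k = v := fun v hv => ⟨u ⟨v, hv⟩, by simp [t]⟩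
  obtain ⟨β, hβ, hβ0, hβq, hβu⟩ := hq.exists_affine_dependency (by omega) ht
  have heqt : ∀ w, ∑ l, Ω (t w) (t l) • (q (t w) - q (t l)) = 0 := by
    intro w
    rw [← heq (t w)]
    rw [← Finset.sum_image (s := Finset.univ) (g := t)
      (f := fun l => Ω (t w) l • (q (t w) - q l)) ht.injOn]
    refine Finset.sum_subset (Finset.subset_univ _) fun l _ hl => ?_
    have h1 : (t w, l) ∉ E := by
      rw [hEV, Finset.mem_offDiag]
      rintro ⟨-, h2, -⟩
      obtain ⟨k, hk⟩ := htsurj l h2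
      exact hl (Finset.mem_image.2 ⟨k, Finset.mem_univ _, hk⟩)
    rw [hΩ0 _ _ h1, zero_smul]
  obtain ⟨c, hc⟩ := exists_stress_eq_mul (by omega) hβ hβu
    (Ω := fun k l => Ω (t k) (t l)) (fun k l => hΩsymm _ _) heqt
  have hψ : ∀ k l, ∃ e : Fin (d + 2) × Fin (d + 2), k ≠ l → e.1 ≠ e.2 ∧ g e = (t k, t l) := by
    intro k l
    by_cases hkl : k = l
    · exact ⟨(k, l), fun h => absurd hkl h⟩
    · have h1 : (t k, t l) ∈ E := by
        rw [hEV, Finset.mem_offDiag]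
        exact ⟨htV k, htV l, ht.ne hkl⟩
      obtain ⟨e, he, h2⟩ := Finset.mem_image.1 h1
      exact ⟨e, fun _ => ⟨(hmem e).1 he, h2⟩⟩
  choose ψ hψ using hψ
  have hprod : ∀ k l, k ≠ l → α (ψ k l).1 * α (ψ k l).2 = c * (β k * β l) := by
    intro k l hkl
    obtain ⟨h1, h2⟩ := hψ k l hkl
    rw [← hc k l hkl, ← hΩval _ h1, h2]
  have hc0 : c ≠ 0 := by
    rintro rfl
    have h1 := hprod 0 1 (by simp)
    rw [zero_mul] at h1
    exact mul_ne_zero (hα _) (hα _) h1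
  obtain ⟨s, hs⟩ := (hp.logFree hr hα hα0 hαp hαu).exists_perm (by omega) hα hβ hβ0 hc0
    (fun k l hkl => (hψ k l hkl).1)
    (fun k l hkl => by
      refine hginj _ _ (hψ l k hkl.symm).1 (Ne.symm (hψ k l hkl).1) ?_
      rw [(hψ l k hkl.symm).2, hgs _ (hψ k l hkl).1, (hψ k l hkl).2]
      rfl)
    (fun i j hij => by
      have h1 : g (i, j) ∈ E := Finset.mem_image_of_mem _ ((hmem _).2 hij)
      rw [hEV, Finset.mem_offDiag] at h1
      obtain ⟨k, hk⟩ := htsurj _ h1.1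
      obtain ⟨l, hl⟩ := htsurj _ h1.2.1
      have hkl : k ≠ l := by
        rintro rfl
        exact h1.2.2 (hk.symm.trans hl)
      refine ⟨k, l, hkl, hginj _ _ (hψ k l hkl).1 hij ?_⟩
      rw [(hψ k l hkl).2, hk, hl])
    hprod
  refine ⟨t ∘ s.symm, ht.comp s.symm.injective, fun i j => ?_⟩
  by_cases hij : i = j
  · simp [hij, sqDist]
  have hne : s.symm i ≠ s.symm j := s.symm.injective.ne hij
  have h1 := hg (ψ (s.symm i) (s.symm j))
  rw [(hψ _ _ hne).2] at h1
  rw [Function.comp_apply, Function.comp_apply, ← h1]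
  rcases hs _ _ hne with h2 | h2
  · rw [h2, Equiv.apply_symm_apply, Equiv.apply_symm_apply]
  · rw [h2, Equiv.apply_symm_apply, Equiv.apply_symm_apply]
    exact (sqDist_swap p (r i, r j)).symm

end Clique

/-! ### Congruence by trilateration -/

section Trilateration

variable {d n : ℕ} {p q : Configuration d n} {π : Equiv.Perm (Fin n)}

/-- Families of `d + 2` points of `p` and `q` with equal distances are congruent, where those of
`p` are in general position. -/
theorem DistGeneric.exists_affineIsometryEquiv (hp : DistGeneric p) (hn : d + 1 ≤ n)
    {r t : Fin (d + 2) → Fin n} (hr : Function.Injective r)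
    (h : ∀ i j, sqDist p (r i, r j) = sqDist q (t i, t j)) :
    ∃ T : EuclideanSpace ℝ (Fin d) ≃ᵃⁱ[ℝ] EuclideanSpace ℝ (Fin d), ∀ k, T (p (r k)) = q (t k) := by
  have hdist : ∀ i j, dist (p (r i)) (p (r j)) = dist (q (t i)) (q (t j)) := fun i j =>
    (pow_left_inj₀ dist_nonneg dist_nonneg two_ne_zero).1 (h i j)
  have ha := hp.affineIndependent hn (hr.comp (Fin.castSucc_injective (d + 1)))
  obtain ⟨T, hT⟩ := exists_affineIsometryEquiv_of_simplex ha
    (b := fun k : Fin (d + 1) => q (t k.castSucc)) fun k l => hdist _ _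
  refine ⟨T, fun k => Fin.lastCases ?_ (fun k => hT k) k⟩
  have h1 : p (r (Fin.last (d + 1))) = T.symm (q (t (Fin.last (d + 1)))) := by
    refine eq_of_dist_simplex_eq ha fun k => ?_
    change dist (p (r _)) (p (r k.castSucc)) = _
    rw [hdist, ← T.dist_map (T.symm _), T.apply_symm_apply, hT k]
  rw [h1, T.apply_symm_apply]

/-- If the matched edges allow for trilateration, then `q` is congruent to `p` up to a permutation
of the vertices. -/
theorem MatchedTrilateration.exists_perm (h : MatchedTrilateration p q π) (hp : IsGeneric p)
    (hd : 2 ≤ d) (hn : d + 2 ≤ n) :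
    ∃ (τ : Equiv.Perm (Fin n)) (T : EuclideanSpace ℝ (Fin d) ≃ᵃⁱ[ℝ] EuclideanSpace ℝ (Fin d)),
      ∀ i, T (p i) = q (τ i) := by
  have hq := h.distGeneric hp hn
  have hpinj := hp.injective (by omega : 0 < d)
  have key : ∀ m, d + 2 ≤ m → m ≤ n → ∃ (τ : Fin n → Fin n)
      (T : EuclideanSpace ℝ (Fin d) ≃ᵃⁱ[ℝ] EuclideanSpace ℝ (Fin d)),
      ∀ i : Fin n, (i : ℕ) < m → T (p (π i)) = q (τ i) := by
    intro m hm
    induction m, hm using Nat.le_induction with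
    | base =>
      intro _
      let c : Fin (d + 2) → Fin n := Fin.castLE hn
      have hc : Function.Injective c := Fin.castLE_injective hn
      obtain ⟨t, -, ht⟩ := h.exists_clique hp hd hn (π.injective.comp hc) fun i j hij =>
        h.base _ _ i.2 j.2 (hc.ne hij)
      obtain ⟨T, hT⟩ := hp.distGeneric.exists_affineIsometryEquiv (by omega)
        (π.injective.comp hc) ht
      refine ⟨fun i => if hi : (i : ℕ) < d + 2 then t ⟨i, hi⟩ else i, T, fun i hi => ?_⟩
      simp only [dif_pos hi]
      exact hT ⟨i, hi⟩
    | succ m hm ih =>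
      intro hmn
      obtain ⟨τ, T, hT⟩ := ih (by omega)
      let j : Fin n := ⟨m, hmn⟩
      obtain ⟨r, hr⟩ := h.step j hm
      have hrm : ∀ k, (r k : ℕ) < m := fun k => (hr k).1
      have hτ : ∀ k l, k ≠ l → τ (r k) ≠ τ (r l) := by
        intro k l hkl h1
        have h2 := (hT _ (hrm k)).trans ((congrArg q h1).trans (hT _ (hrm l)).symm)
        exact hkl (r.injective (π.injective (hpinj (T.injective h2))))
      have hdist : ∀ k l, sqDist p (π (r k), π (r l)) = sqDist q (τ (r k), τ (r l)) := by
        intro k l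
        rw [sqDist, sqDist, ← hT _ (hrm k), ← hT _ (hrm l), T.dist_map]
      -- the new vertex and its neighbours form a complete graph of matched edges
      let ρ : Fin (d + 2) → Fin n := Fin.snoc (α := fun _ => Fin n) (fun k => π (r k)) (π j)
      have hρs : ∀ k : Fin (d + 1), ρ k.castSucc = π (r k) := fun k => by simp [ρ]
      have hρl : ρ (Fin.last (d + 1)) = π j := by simp [ρ]
      have hρ : Function.Injective ρ :=
        Fin.snoc_injective_of_injective (π.injective.comp r.injective) (by
          rintro ⟨k, hk⟩
          exact (hr k).1.ne (π.injective hk))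
      have hsymm : ∀ a b, IsMatched p q a b → IsMatched p q b a := by
        rintro a b ⟨h1, f, h2⟩
        exact ⟨h1.symm, f, (sqDist_swap p (a, b)).trans h2⟩
      have hm' : ∀ a b, a ≠ b → IsMatched p q (ρ a) (ρ b) := by
        intro a b
        refine Fin.lastCases (fun hab => ?_) (fun k hab => ?_) a
        · revert hab
          refine Fin.lastCases (fun hab => absurd rfl hab) (fun l _ => ?_) b
          rw [hρs, hρl]
          exact hsymm _ _ (hr l).2
        · revert hab
          refine Fin.lastCases (fun _ => ?_) (fun l hab => ?_) b
          · rw [hρs, hρl]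
            exact (hr k).2
          · refine ⟨hρ.ne hab, ?_⟩
            rw [hρs, hρs]
            exact ⟨_, hdist k l⟩
      obtain ⟨t, htinj, ht⟩ := h.exists_clique hp hd hn hρ hm'
      -- a vertex of a complete graph on at least three vertices is determined by its edges
      have htτ : ∀ k : Fin (d + 1), t k.castSucc = τ (r k) := by
        intro k
        have h1 : ∀ l, k ≠ l → t k.castSucc = τ (r k) ∨ t k.castSucc = τ (r l) := by
          intro l hkl
          have h2 := ht k.castSucc l.castSucc
          rw [hρs, hρs, hdist] at h2
          rcases hq.eq_of_sqDist_eq (by omega) (hτ k l hkl)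
            (htinj.ne ((Fin.castSucc_injective _).ne hkl)) h2 with ⟨h3, -⟩ | ⟨-, h3⟩
          · exact Or.inl h3.symm
          · exact Or.inr h3.symm
        obtain ⟨a, ha, -⟩ := exists_ne_ne (by omega : 3 ≤ d + 1) k k
        obtain ⟨b, hb, hba⟩ := exists_ne_ne (by omega : 3 ≤ d + 1) k a
        rcases h1 a ha.symm with h2 | h2
        · exact h2
        · rcases h1 b hb.symm with h3 | h3
          · exact h3
          · exact absurd (h3.symm.trans h2) (hτ b a hba)
      have hnew : T (p (π j)) = q (t (Fin.last (d + 1))) := by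
        refine eq_of_dist_simplex_eq (hq.affineIndependent (by omega)
          (r := fun k => t k.castSucc) (htinj.comp (Fin.castSucc_injective _))) fun k => ?_
        have h1 := ht (Fin.last (d + 1)) k.castSucc
        rw [hρs, hρl] at h1
        rw [← (pow_left_inj₀ dist_nonneg dist_nonneg two_ne_zero).1 h1, htτ, ← hT _ (hrm k),
          T.dist_map]
      refine ⟨Function.update τ j (t (Fin.last (d + 1))), T, fun i hi => ?_⟩
      by_cases hij : i = j
      · rw [hij, Function.update_self, hnew]
      · rw [Function.update_of_ne hij]
        have h1 : (i : ℕ) ≠ m := fun h1 => hij (Fin.ext h1)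
        exact hT i (by omega)
  obtain ⟨τ, T, hT⟩ := key n hn le_rfl
  have hτ : Function.Injective τ := by
    intro i j hij
    have h1 := (hT i i.2).trans ((congrArg q hij).trans (hT j j.2).symm)
    exact π.injective (hpinj (T.injective h1))
  refine ⟨π.symm.trans (Equiv.ofBijective τ (Finite.injective_iff_bijective.1 hτ)), T, fun i => ?_⟩
  have h1 := hT (π.symm i) (π.symm i).2
  rwa [Equiv.apply_symm_apply] at h1

end Trilateration

/-! ### Edge measurement ensembles -/

section Ensemble

variable {d n : ℕ}

theorem exists_edgeLength_sq_eq_sqDist (x : Configuration d n) (e : Edge n) :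
    ∃ i j, e.1 = s(i, j) ∧ i ≠ j ∧ edgeLength x e ^ 2 = sqDist x (i, j) := by
  obtain ⟨e, he⟩ := e
  induction e using Sym2.ind with
  | _ i j => exact ⟨i, j, rfl, fun h => he (Sym2.mk_isDiag_iff.2 h), rfl⟩

theorem edgeLength_sq_eq_sqDist (x : Configuration d n) {e : Edge n} {i j : Fin n}
    (h : e.1 = s(i, j)) : edgeLength x e ^ 2 = sqDist x (i, j) := by
  obtain ⟨e, he⟩ := e
  subst h
  rfl

theorem IsMatched.of_includes {p q : Configuration d n} {G H : EdgeEnsemble n}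
    (hv : squaredData G p = squaredData H q) {i j : Fin n} (hij : i ≠ j) (h : Includes G i j) :
    IsMatched p q i j := by
  obtain ⟨e, he, h1⟩ := h
  have h2 : edgeLength p e ^ 2 ∈ squaredData H q := hv ▸ List.mem_map_of_mem he
  obtain ⟨f, -, h3⟩ := List.mem_map.1 h2
  obtain ⟨k, l, -, -, h4⟩ := exists_edgeLength_sq_eq_sqDist q f
  exact ⟨hij, (k, l), by rw [← h4, h3, edgeLength_sq_eq_sqDist p h1]⟩

theorem DistGeneric.injective_edgeLength_sq {p : Configuration d n} (hp : DistGeneric p)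
    (hd : 0 < d) : Function.Injective fun e : Edge n => edgeLength p e ^ 2 := by
  intro e f h
  obtain ⟨i, j, h1, h2, h3⟩ := exists_edgeLength_sq_eq_sqDist p e
  obtain ⟨k, l, h4, h5, h6⟩ := exists_edgeLength_sq_eq_sqDist p f
  refine Subtype.ext ?_
  rw [h1, h4, Sym2.eq_iff]
  exact hp.eq_of_sqDist_eq hd h2 h5 (h3.symm.trans (h.trans h6))

theorem edgeLength_relabelEdge {p q : Configuration d n} {σ : Equiv.Perm (Fin n)}
    (h : ∀ i j, dist (p (σ i)) (p (σ j)) = dist (q i) (q j)) (e : Edge n) :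
    edgeLength p (relabelEdge σ e) = edgeLength q e := by
  obtain ⟨e, he⟩ := e
  induction e using Sym2.ind with
  | _ i j => exact h i j

end Ensemble

end UnlabeledTrilateration

theorem theorem5p12 (d n : ℕ) (hd : 2 ≤ d) (hn : d + 2 ≤ n)
    (p : UnlabeledTrilateration.Configuration d n) (hp : UnlabeledTrilateration.IsGeneric p)
    (G : UnlabeledTrilateration.EdgeEnsemble n)
    (hG : UnlabeledTrilateration.AllowsTrilateration d G)
    (q : UnlabeledTrilateration.Configuration d n) (H : UnlabeledTrilateration.EdgeEnsemble n)
    (hv : UnlabeledTrilateration.squaredData G p = UnlabeledTrilateration.squaredData H q) :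
    ∃ σ : Equiv.Perm (Fin n),
      UnlabeledTrilateration.IsCongruent (UnlabeledTrilateration.relabelConfiguration σ q) p ∧
        UnlabeledTrilateration.relabelEnsemble σ H = G := by
  obtain ⟨-, π, hbase, hstep⟩ := hG
  have hmt : UnlabeledTrilateration.MatchedTrilateration p q π :=
    { base := fun i j hi hj hij => .of_includes hv (π.injective.ne hij) (hbase i j hi hj hij)
      step := fun j hj => by
        obtain ⟨r, hr⟩ := hstep j hj
        exact ⟨r, fun k => ⟨(hr k).1, .of_includes hv (π.injective.ne (hr k).1.ne) (hr k).2⟩⟩ }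
  obtain ⟨τ, T, hT⟩ := hmt.exists_perm hp hd hn
  refine ⟨τ.symm, ⟨T.symm, fun i => ?_⟩, ?_⟩
  · change T.symm (q (τ i)) = p i
    rw [← hT, T.symm_apply_apply]
  · -- both sides have the same data in `p`, where distinct edges have distinct lengths
    refine List.map_injective_iff.2 (hp.distGeneric.injective_edgeLength_sq (by omega)) ?_
    have h1 : ∀ e, UnlabeledTrilateration.edgeLength p
        (UnlabeledTrilateration.relabelEdge τ.symm e) = UnlabeledTrilateration.edgeLength q e :=
      UnlabeledTrilateration.edgeLength_relabelEdge fun i j => by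
        rw [← T.dist_map, hT, hT, τ.apply_symm_apply, τ.apply_symm_apply]
    rw [UnlabeledTrilateration.relabelEnsemble, List.map_map]
    simp only [Function.comp_def, h1]
    exact hv.symm
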